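/- Let $X=\mathbb R/\mathbb Z$. For $n\ge 1$, a $C^n$ (orientation preserving) expanding map of $X$ is a map $T:X\to X$ with a $C^n$ lift $F:\mathbb R\to\mathbb R$ such that $\inf F'>1$. Its transfer operator is $\mathcal L_T w(x)=\sum_{Ty=x} w(y)/T'(y)$, and an invariant density of $T$ is a $\rho\in L^1(X)$ with $\rho\ge 0$, $\int_X\rho\,dx=1$ and $\mathcal L_T\rho=\rho$. Given a $C^3$ expanding map $T_0$ and $\varepsilon\in C^3(X,\mathbb R)$, a family $(T_\delta)_{\delta\in(-\eta,\eta)}$, $\eta>0$, of $C^3$ expanding maps is said to have first-order perturbation $\varepsilon$ if it passes through $T_0$ at $\delta=0$ and $\|(T_\delta-T_0)/\delta-\varepsilon\|_{C^3}\to 0$ as $\delta\to 0$. We say that $\rho^{(1)}$ is the linear response of $T_0$ to $\varepsilon$ if families with first-order perturbation $\varepsilon$ exist and if, for every such family, each $T_\delta$ has a unique invariant density $\rho_\delta$ and $\|(\rho_\delta-\rho_0)/\delta-\rho^{(1)}\|_{L^1(X)}\to 0$ as $\delta\to 0$. Theorem. Let $k\ge 4$, let $T_0$ be a $C^k$ orientation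 preserving expanding map of the circle, and let $\rho^{(1)}\in C^{k-2}(X,\mathbb R)$ satisfy $\int_X\rho^{(1)}\,dx=0$. Then there is an $\varepsilon\in C^{k-1}(X,\mathbb R)$ such that $\rho^{(1)}$ is the linear response of $T_0$ to $\varepsilon$. Moreover, the set of such $\varepsilon$ is infinite dimensional: it contains $\varepsilon_0+V$ for some function $\varepsilon_0$ and some infinite-dimensional real vector space $V$ of functions on $X$. -/

import Mathlib

open MeasureTheory Filter Topology

/-- A real function on the circle `ℝ/ℤ` is of class `C^n`: its pull-back to `ℝ` is `C^n`. -/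
def CircleContDiff (n : ℕ) (f : UnitAddCircle → ℝ) : Prop :=
  ContDiff ℝ n (fun x : ℝ => f (x : UnitAddCircle))

/-- `F : ℝ → ℝ` is a lift of the circle map `T`. -/
def IsLift (F : ℝ → ℝ) (T : UnitAddCircle → UnitAddCircle) : Prop :=
  ∀ x : ℝ, T (x : UnitAddCircle) = ((F x : ℝ) : UnitAddCircle)

/-- `C^n` orientation preserving expanding maps of the circle: there is a `C^n` lift whose
derivative is bounded below by a constant larger than one (so the degree is at least two). -/
def IsExpandingMap (n : ℕ) (T : UnitAddCircle → UnitAddCircle) : Prop :=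
  ∃ F : ℝ → ℝ, IsLift F T ∧ ContDiff ℝ n F ∧ ∃ c : ℝ, 1 < c ∧ ∀ x : ℝ, c ≤ deriv F x

/-- The representative in `[-1/2, 1/2)` of a point of the circle. -/
noncomputable def circleRep (z : UnitAddCircle) : ℝ :=
  (AddCircle.equivIco (1 : ℝ) (-1 / 2) z : ℝ)

/-- The derivative `T'(y)` of a circle map `T` at `y`: the derivative at `t = 0` of the (signed,
small) real displacement `T (y + t) - T y`. -/
noncomputable def circleDeriv (T : UnitAddCircle → UnitAddCircle) (y : UnitAddCircle) : ℝ :=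
  deriv (fun t : ℝ => circleRep (T (y + (t : UnitAddCircle)) - T y)) 0

theorem circleRep_coe {s : ℝ} (h₁ : -1 / 2 ≤ s) (h₂ : s < 1 / 2) :
    circleRep (s : UnitAddCircle) = s := by
  have hs : s ∈ Set.Ico (-1 / 2 : ℝ) (-1 / 2 + 1) := ⟨h₁, by linarith⟩
  unfold circleRep
  rw [AddCircle.equivIco_coe_eq (p := (1 : ℝ)) (a := -1 / 2) hs]

/-- The derivative of a circle map is the derivative of any of its lifts. -/
theorem circleDeriv_eq_deriv_lift {F : ℝ → ℝ} {T : UnitAddCircle → UnitAddCircle}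
    (hF : IsLift F T) (hd : Differentiable ℝ F) (x : ℝ) :
    circleDeriv T (x : UnitAddCircle) = deriv F x := by
  have hev : (fun t : ℝ => circleRep (T ((x : UnitAddCircle) + (t : UnitAddCircle)) -
      T (x : UnitAddCircle))) =ᶠ[𝓝 0] fun t : ℝ => F (x + t) - F x := by
    have hc : Continuous fun t : ℝ => F (x + t) - F x :=
      (hd.continuous.comp (continuous_const.add continuous_id)).sub continuous_const
    have hm : Set.Ioo (-1 / 2 : ℝ) (1 / 2) ∈ 𝓝 ((fun t : ℝ => F (x + t) - F x) 0) := by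
      apply Ioo_mem_nhds <;> norm_num
    filter_upwards [hc.continuousAt hm] with t ht
    rw [← AddCircle.coe_add, hF, hF, ← AddCircle.coe_sub]
    exact circleRep_coe ht.1.le ht.2
  unfold circleDeriv
  rw [hev.deriv_eq, deriv_sub_const, deriv_comp_const_add, add_zero]

/-- The transfer operator `(L w)(x) = ∑ w(y) / T'(y)`, the sum running over the preimages `y` of
`x` (which are finitely many for an expanding map). -/
noncomputable def transferOperator (T : UnitAddCircle → UnitAddCircle) (w : UnitAddCircle → ℝ) :
    UnitAddCircle → ℝ :=
  fun x => ∑ᶠ (y : UnitAddCircle) (_ : T y = x), w y / circleDeriv T y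

/-- `ρ` is an invariant density of `T`: a probability density with respect to the normalized
Lebesgue measure of the circle that is fixed, in `L¹`, by the transfer operator. -/
structure IsInvariantDensity (T : UnitAddCircle → UnitAddCircle) (ρ : UnitAddCircle → ℝ) :
    Prop where
  integrable : Integrable ρ volume
  nonneg : ∀ᵐ x ∂volume, 0 ≤ ρ x
  integral_eq_one : ∫ x, ρ x ∂volume = 1
  fixed : transferOperator T ρ =ᵐ[volume] ρ

/-- `ρ` is the invariant density of `T`, unique as an element of `L¹`. -/
def IsUniqueInvariantDensity (T : UnitAddCircle → UnitAddCircle) (ρ : UnitAddCircle → ℝ) : Prop :=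
  IsInvariantDensity T ρ ∧ ∀ ρ' : UnitAddCircle → ℝ, IsInvariantDensity T ρ' → ρ' =ᵐ[volume] ρ

/-- `(T δ)`, `|δ| < η`, is a family of `C³` expanding maps with `T 0 = T₀` and, for the
`C³` function `ε`, `T δ = T₀ + δ ε + o(δ)` in the `C³` topology: for suitable lifts `F δ`, the function
`(F δ - F 0) / δ - ε` tends to `0` uniformly together with its first three derivatives. -/
structure IsDifferentiableFamily (T₀ : UnitAddCircle → UnitAddCircle) (ε : UnitAddCircle → ℝ)
    (η : ℝ) (T : ℝ → UnitAddCircle → UnitAddCircle) : Prop where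
  smooth : CircleContDiff 3 ε
  zero : T 0 = T₀
  expanding : ∀ δ : ℝ, |δ| < η → IsExpandingMap 3 (T δ)
  expansion : ∃ F : ℝ → ℝ → ℝ,
    (∀ δ : ℝ, |δ| < η → IsLift (F δ) (T δ) ∧ ContDiff ℝ 3 (F δ)) ∧
    ∀ j : ℕ, j ≤ 3 → TendstoUniformly
      (fun δ : ℝ => iteratedDeriv j
        (fun x : ℝ => (F δ x - F 0 x) / δ - ε (x : UnitAddCircle)))
      (fun _ => 0) (𝓝[≠] 0)

/-- `ρ₁` is the linear response of the invariant density of `T₀` to the first-order perturbation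
`ε` of the map: there are families `T δ = T₀ + δ ε + o(δ)`, and for each of them every `T δ` has a
unique invariant density `ρ δ`, with `(ρ δ - ρ 0) / δ → ρ₁` in `L¹` as `δ → 0`. -/
def IsLinearResponse (T₀ : UnitAddCircle → UnitAddCircle) (ε ρ₁ : UnitAddCircle → ℝ) : Prop :=
  (∃ η : ℝ, 0 < η ∧ ∃ T : ℝ → UnitAddCircle → UnitAddCircle, IsDifferentiableFamily T₀ ε η T) ∧
  ∀ η : ℝ, 0 < η → ∀ T : ℝ → UnitAddCircle → UnitAddCircle, IsDifferentiableFamily T₀ ε η T →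
    ∃ ρ : ℝ → UnitAddCircle → ℝ,
      (∀ δ : ℝ, |δ| < η → IsUniqueInvariantDensity (T δ) (ρ δ)) ∧
      Tendsto (fun δ : ℝ =>
          eLpNorm (fun x : UnitAddCircle => (ρ δ x - ρ 0 x) / δ - ρ₁ x) 1 volume)
        (𝓝[≠] 0) (𝓝 0)

/-!
Throughout, the circle map is replaced by a lift `F : ℝ → ℝ` with inverse `g`, functions on the
circle by `1`-periodic functions, and `L` is the transfer operator, a sum over the inverse branches
`g (x + i)`, `i < d`.

**The formula.** If `L_δ` is the transfer operator of `T₀ + δ ε + o(δ)`, then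
`L_δ w = L w - δ (L (ε w))' + o(δ)` (`ExpandingFamily.isLittleO_branchSum`). Subtracting the
equations `L_δ ρ_δ = ρ_δ` and `L ρ₀ = ρ₀` shows that the response `ρ₁` must solve
`(1 - L) ρ₁ = -(L (ε ρ₀))'`. Given `ρ₁`, this is an equation for `ε`: the function `L ρ₁ - ρ₁` has
mean zero, hence a periodic primitive `G`, and `L (ε ρ₀) = G` is solved by `ε = (G / ρ₀) ∘ T₀`
because functions of `T₀` pull out of `L` (`ExpandingLift.exists_comp_branchSum_eq`). Any `v` with
`L (v ρ₀) = 0` can be added, and these `v` form an infinite-dimensional space because `L` adds up at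
least two branches (`ExpandingLift.not_finiteDimensional_silentPerturbations`).

**The spectral gap.** The transfer operator maps the cone `|w'| ≤ K w` strictly inside itself, so
that a fixed proportion of the mass can be split off as a constant
(`ExpandingLift.branchSum_mem_cone`). Hence the iterates decay exponentially on mean-zero `C^1`
functions, with constants depending only on bounds for `1 / F'` and its derivative
(`ExpandingLift.decay`). This gives the invariant density (`ExpandingLift.exists_density`), its
uniqueness in `L^1` (`ExpandingLift.integral_abs_eq_zero_of_fixed`), and an inverse of `1 - L_δ`
that is uniform in `δ`: if `u - L_δ u = f` with `f` bounded in `C^1` and uniformly small, then `u` is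
uniformly small (`ExpandingLift.abs_le_of_sub_branchSum`). The latter, applied to
`u = (ρ_δ - ρ₀) / δ - ρ₁`, proves that the formula does give the response
(`ExpandingFamily.uniform_response`).

**Regularity.** That `ε` is `C^(k-1)` requires `ρ₀` to be. With `a = 1 / F'` one has
`(L w)' = L ((a w)')`, so the derivatives of `ρ₀` solve equations `v = L (b v) + f` with
`|b| ≤ sup a < 1`, and solutions of such equations are as smooth as the data
(`ExpandingLift.contDiff_of_cohomological`).
-/

open Asymptotics

/-! ### The transfer operator of a lift -/

/-- `F` is a `C^r` lift, of degree `d`, of an expanding circle map, and `g` is its inverse on the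
line. The inverse branches of the circle map over `x` are `g (x + i)`, `i < d`. The numbers
`lam < 1` and `D` bound `1 / F'` and its derivative; the decay of the iterates of the transfer
operator depends on the map through them alone, which makes it uniform along a perturbation. -/
structure ExpandingLift (r d : ℕ) (lam D : ℝ) (F g : ℝ → ℝ) : Prop where
  two_le_smoothness : 2 ≤ r
  contDiff : ContDiff ℝ r F
  two_le_degree : 2 ≤ d
  map_add_one : ∀ x, F (x + 1) = F x + d
  lam_lt_one : lam < 1
  deriv_pos : ∀ x, 0 < deriv F x
  inv_deriv_le : ∀ x, (deriv F x)⁻¹ ≤ lam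
  abs_deriv_inv_le : ∀ x, |deriv (fun y => (deriv F y)⁻¹) x| ≤ D
  right_inv : ∀ x, F (g x) = x
  left_inv : ∀ x, g (F x) = x

/-- The transfer operator on functions of a real variable:
`(L w)(x) = ∑ i < d, w (g (x + i)) / F' (g (x + i))`. On `1`-periodic functions this is the transfer
operator of the circle map (`ExpandingLift.transferOperator_coe`). It is a plain linear endomorphism
of the space of all functions, so that its iterates are powers. -/
noncomputable def branchSum (F g : ℝ → ℝ) (d : ℕ) : Module.End ℝ (ℝ → ℝ) where
  toFun w x := ∑ i ∈ Finset.range d, (deriv F (g (x + i)))⁻¹ * w (g (x + i))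
  map_add' u v := by
    funext x
    simp only [Pi.add_apply, mul_add, Finset.sum_add_distrib]
  map_smul' c v := by
    funext x
    simp only [Pi.smul_apply, smul_eq_mul, RingHom.id_apply, Finset.mul_sum]
    exact Finset.sum_congr rfl fun i _ => by ring

theorem branchSum_apply (F g : ℝ → ℝ) (d : ℕ) (w : ℝ → ℝ) (x : ℝ) :
    branchSum F g d w x = ∑ i ∈ Finset.range d, (deriv F (g (x + i)))⁻¹ * w (g (x + i)) := rfl

theorem branchSum_def (F g : ℝ → ℝ) (d : ℕ) (w : ℝ → ℝ) : branchSum F g d w =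
    fun x => ∑ i ∈ Finset.range d, (deriv F (g (x + i)))⁻¹ * w (g (x + i)) := rfl

namespace ExpandingLift

variable {r d : ℕ} {lam D : ℝ} {F g : ℝ → ℝ}

theorem differentiable (h : ExpandingLift r d lam D F g) : Differentiable ℝ F :=
  h.contDiff.differentiable (by have := h.two_le_smoothness; norm_cast; omega)

theorem lam_pos (h : ExpandingLift r d lam D F g) : 0 < lam :=
  (inv_pos.2 (h.deriv_pos 0)).trans_le (h.inv_deriv_le 0)

theorem D_nonneg (h : ExpandingLift r d lam D F g) : 0 ≤ D :=
  (abs_nonneg _).trans (h.abs_deriv_inv_le 0)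

theorem strictMono (h : ExpandingLift r d lam D F g) : StrictMono F :=
  strictMono_of_deriv_pos h.deriv_pos

theorem strictMono_inverse (h : ExpandingLift r d lam D F g) : StrictMono g := fun x y hxy => by
  rw [← h.strictMono.lt_iff_lt, h.right_inv, h.right_inv]; exact hxy

theorem inverse_add_degree (h : ExpandingLift r d lam D F g) (x : ℝ) : g (x + d) = g x + 1 := by
  rw [← h.left_inv (g x + 1), h.map_add_one, h.right_inv]

theorem contDiff_inverse (h : ExpandingLift r d lam D F g) : ContDiff ℝ r g := by
  let e : ℝ ≃o ℝ := h.strictMono.orderIsoOfSurjective F fun x => ⟨g x, h.right_inv x⟩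
  have he : (e.toHomeomorph.symm : ℝ → ℝ) = g := by
    funext x
    apply h.strictMono.injective
    rw [h.right_inv]
    exact e.apply_symm_apply x
  rw [← he]
  exact e.toHomeomorph.contDiff_symm_deriv (f' := deriv F) (fun x => (h.deriv_pos x).ne')
    (fun x => (h.differentiable x).hasDerivAt) h.contDiff

theorem continuous_inverse (h : ExpandingLift r d lam D F g) : Continuous g :=
  h.contDiff_inverse.continuous

theorem hasDerivAt_inverse (h : ExpandingLift r d lam D F g) (x : ℝ) :
    HasDerivAt g (deriv F (g x))⁻¹ x :=
  HasDerivAt.of_local_left_inverse h.continuous_inverse.continuousAt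
    (h.differentiable _).hasDerivAt (h.deriv_pos _).ne' (Eventually.of_forall h.right_inv)

theorem deriv_periodic (h : ExpandingLift r d lam D F g) : Function.Periodic (deriv F) 1 := by
  intro x
  rw [← deriv_comp_add_const]
  simp [h.map_add_one]

theorem contDiff_deriv (h : ExpandingLift r d lam D F g) {m : ℕ} (hm : m + 1 ≤ r) :
    ContDiff ℝ m (deriv F) := by
  have : ContDiff ℝ ((m : WithTop ℕ∞) + 1) F := h.contDiff.of_le (by exact_mod_cast hm)
  exact (contDiff_succ_iff_deriv.1 this).2.2

theorem contDiff_inv_deriv (h : ExpandingLift r d lam D F g) {m : ℕ} (hm : m + 1 ≤ r) :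
    ContDiff ℝ m (fun y => (deriv F y)⁻¹) :=
  (h.contDiff_deriv hm).inv fun x => (h.deriv_pos x).ne'

theorem inv_deriv_periodic (h : ExpandingLift r d lam D F g) :
    Function.Periodic (fun y => (deriv F y)⁻¹) 1 := fun x => by
  simp only [h.deriv_periodic x]

theorem inv_deriv_nonneg (h : ExpandingLift r d lam D F g) (x : ℝ) : 0 ≤ (deriv F x)⁻¹ :=
  (inv_pos.2 (h.deriv_pos x)).le

theorem branchSum_mono (h : ExpandingLift r d lam D F g) {u v : ℝ → ℝ} (huv : ∀ x, u x ≤ v x)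
    (x : ℝ) : branchSum F g d u x ≤ branchSum F g d v x := by
  rw [branchSum_apply, branchSum_apply]
  exact Finset.sum_le_sum fun _ _ => mul_le_mul_of_nonneg_left (huv _) (h.inv_deriv_nonneg _)

theorem abs_branchSum_le (h : ExpandingLift r d lam D F g) {u v : ℝ → ℝ}
    (huv : ∀ x, |u x| ≤ v x) (x : ℝ) : |branchSum F g d u x| ≤ branchSum F g d v x := by
  rw [branchSum_apply, branchSum_apply]
  refine (Finset.abs_sum_le_sum_abs _ _).trans (Finset.sum_le_sum fun i _ => ?_)
  rw [abs_mul, abs_of_nonneg (h.inv_deriv_nonneg _)]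
  exact mul_le_mul_of_nonneg_left (huv _) (h.inv_deriv_nonneg _)

theorem branchSum_periodic (h : ExpandingLift r d lam D F g) {w : ℝ → ℝ}
    (hw : Function.Periodic w 1) : Function.Periodic (branchSum F g d w) 1 := by
  intro x
  have hq : (deriv F (g (x + d)))⁻¹ * w (g (x + d)) = (deriv F (g x))⁻¹ * w (g x) := by
    rw [h.inverse_add_degree, h.deriv_periodic, hw]
  have h1 := Finset.sum_range_succ (fun i : ℕ => (deriv F (g (x + i)))⁻¹ * w (g (x + i))) d
  have h2 := Finset.sum_range_succ' (fun i : ℕ => (deriv F (g (x + i)))⁻¹ * w (g (x + i))) d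
  rw [h1] at h2
  simp only [Nat.cast_zero, add_zero, hq, add_left_inj] at h2
  rw [branchSum_apply, branchSum_apply, h2]
  refine Finset.sum_congr rfl fun i _ => ?_
  rw [show x + 1 + (i : ℝ) = x + ((i + 1 : ℕ) : ℝ) by push_cast; ring]

theorem contDiff_branchSum (h : ExpandingLift r d lam D F g) {m : ℕ} (hm : m + 1 ≤ r)
    {w : ℝ → ℝ} (hw : ContDiff ℝ m w) : ContDiff ℝ m (branchSum F g d w) := by
  have hg (i : ℕ) : ContDiff ℝ m (fun x => g (x + i)) :=
    (h.contDiff_inverse.of_le (by exact_mod_cast (by omega : m ≤ r))).comp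
      (contDiff_id.add contDiff_const)
  rw [branchSum_def]
  exact ContDiff.sum fun i _ => ((h.contDiff_inv_deriv hm).mul hw).comp (hg i)

/-- With `a = 1 / F'`, the derivative of `L w` is `L ((a w)')`: differentiating does not leave the
range of `L`, which is why all estimates on derivatives reduce to positivity of `L`. -/
theorem deriv_branchSum (h : ExpandingLift r d lam D F g) {w : ℝ → ℝ} (hw : ContDiff ℝ 1 w) :
    deriv (branchSum F g d w) =
      branchSum F g d (deriv fun y => (deriv F y)⁻¹ * w y) := by
  funext x
  have ha : ContDiff ℝ 1 (fun y => (deriv F y)⁻¹ * w y) :=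
    (h.contDiff_inv_deriv (m := 1) h.two_le_smoothness).mul hw
  have hi (i : ℕ) : HasDerivAt (fun x => (deriv F (g (x + i)))⁻¹ * w (g (x + i)))
      ((deriv F (g (x + i)))⁻¹ * deriv (fun y => (deriv F y)⁻¹ * w y) (g (x + i))) x := by
    have h1 := ((ha.differentiable one_ne_zero) (g (x + i))).hasDerivAt
    have h2 := h1.comp x ((h.hasDerivAt_inverse (x + i)).comp_add_const x i)
    rw [mul_comm]
    exact h2
  rw [branchSum_def, branchSum_apply]
  exact (HasDerivAt.fun_sum fun i _ => hi i).deriv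

theorem tendsto_branchSum {ι : Type*} {l : Filter ι} {u : ι → ℝ → ℝ} {v : ℝ → ℝ}
    (huv : ∀ x, Tendsto (fun n => u n x) l (𝓝 (v x))) (x : ℝ) :
    Tendsto (fun n => branchSum F g d (u n) x) l (𝓝 (branchSum F g d v x)) := by
  simp only [branchSum_apply]
  exact tendsto_finsetSum _ fun _ _ => (huv _).const_mul _

/-- The transfer operator preserves integrals, by the change of variables `x = F y`; no regularity
of `w` beyond integrability is needed. -/
theorem integral_branchSum (h : ExpandingLift r d lam D F g) {w : ℝ → ℝ}
    (hw : Function.Periodic w 1) (hi : IntervalIntegrable w volume 0 1) :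
    IntervalIntegrable (branchSum F g d w) volume 0 1 ∧
      ∫ x in (0 : ℝ)..1, branchSum F g d w x = ∫ x in (0 : ℝ)..1, w x := by
  have hd : (0 : ℝ) ≤ d := d.cast_nonneg
  have hall : ∀ s t, IntervalIntegrable w volume s t :=
    hw.intervalIntegrable one_ne_zero (t := 0) (by simpa using hi)
  set q : ℝ → ℝ := fun x => (deriv F (g x))⁻¹ * w (g x) with hq
  have habs : (fun x => |(deriv F (g x))⁻¹| • w (g x)) = q := by
    funext x
    rw [abs_of_nonneg (h.inv_deriv_nonneg _), smul_eq_mul]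
  have himg (s t : ℝ) : g '' Set.Ioc s t = Set.Ioc (g s) (g t) := by
    let e : ℝ ≃o ℝ := h.strictMono_inverse.orderIsoOfSurjective g fun x => ⟨F x, h.left_inv x⟩
    exact e.image_Ioc s t
  have hqi (s t : ℝ) (hst : s ≤ t) : IntervalIntegrable q volume s t := by
    rw [intervalIntegrable_iff_integrableOn_Ioc_of_le hst, ← habs,
      ← integrableOn_image_iff_integrableOn_abs_deriv_smul measurableSet_Ioc
        (fun x _ => (h.hasDerivAt_inverse x).hasDerivWithinAt)
        h.strictMono_inverse.injective.injOn w, himg]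
    exact (hall _ _).1
  have hqint : ∫ x in (0 : ℝ)..d, q x = ∫ x in g 0..g 0 + 1, w x := by
    have hgd : g d = g 0 + 1 := by simpa using h.inverse_add_degree 0
    rw [intervalIntegral.integral_of_le hd, ← habs,
      ← integral_image_eq_integral_abs_deriv_smul measurableSet_Ioc
        (fun x _ => (h.hasDerivAt_inverse x).hasDerivWithinAt)
        h.strictMono_inverse.injective.injOn w, himg, hgd,
      intervalIntegral.integral_of_le (by linarith)]
  have hqs (i : ℕ) : IntervalIntegrable (fun x => q (x + i)) volume 0 1 := by
    have := (hqi i (i + 1) (by linarith)).comp_add_right (i : ℝ)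
    simpa using this
  have hL : branchSum F g d w = fun x => ∑ i ∈ Finset.range d, q (x + i) := rfl
  have hL' : branchSum F g d w = ∑ i ∈ Finset.range d, fun x => q (x + i) := by
    rw [hL]; ext x; simp
  refine ⟨hL' ▸ IntervalIntegrable.sum _ fun i _ => hqs i, ?_⟩
  rw [hL, intervalIntegral.integral_finsetSum fun i _ => hqs i]
  calc ∑ i ∈ Finset.range d, ∫ x in (0 : ℝ)..1, q (x + i)
      = ∑ i ∈ Finset.range d, ∫ x in ((i : ℕ) : ℝ)..((i + 1 : ℕ) : ℝ), q x := by
        refine Finset.sum_congr rfl fun i _ => ?_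
        rw [intervalIntegral.integral_comp_add_right]
        push_cast
        rw [zero_add, add_comm]
    _ = ∫ x in (0 : ℝ)..d, q x := by
        rw [intervalIntegral.sum_integral_adjacent_intervals (a := fun i : ℕ => (i : ℝ))
          fun i _ => hqi _ _ (by push_cast; linarith)]
        simp
    _ = ∫ x in (0 : ℝ)..1, w x := by
        rw [hqint, hw.intervalIntegral_add_eq (g 0) 0, zero_add]

end ExpandingLift

/-! ### Invariant cone, decay of iterates and the fixed density -/

theorem periodic_deriv_of_periodic {w : ℝ → ℝ} (hw : Function.Periodic w 1) :
    Function.Periodic (deriv w) 1 := fun x => by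
  rw [← deriv_comp_add_const]
  exact congrArg (fun u => deriv u x) (funext hw)

theorem exists_abs_le_of_periodic {w : ℝ → ℝ} (hw : Function.Periodic w 1) (hc : Continuous w) :
    ∃ B, 0 < B ∧ ∀ x, |w x| ≤ B := by
  obtain ⟨B, hB⟩ := isCompact_Icc.exists_bound_of_continuousOn (s := Set.Icc (0 : ℝ) 1)
    hc.continuousOn
  refine ⟨max B 1, by positivity, fun x => ?_⟩
  obtain ⟨y, hy, hxy⟩ := hw.exists_mem_Ico₀ one_pos x
  rw [hxy]
  exact (hB y ⟨hy.1, hy.2.le⟩).trans (le_max_left _ _)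

/-- The cone of log-Lipschitz densities: `C^1` periodic functions of mass `m` with `|w'| ≤ K w`
(which forces `0 ≤ w`). -/
structure InCone (K m : ℝ) (w : ℝ → ℝ) : Prop where
  contDiff : ContDiff ℝ 1 w
  periodic : Function.Periodic w 1
  abs_deriv_le : ∀ x, |deriv w x| ≤ K * w x
  integral_eq : ∫ x in (0 : ℝ)..1, w x = m

namespace InCone

variable {K m : ℝ} {w : ℝ → ℝ}

theorem nonneg (hK : 0 < K) (h : InCone K m w) (x : ℝ) : 0 ≤ w x :=
  nonneg_of_mul_nonneg_right ((abs_nonneg _).trans (h.abs_deriv_le x)) hK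

/-- Harnack inequality: `t ↦ exp (K t) * w t` is monotone, and periodicity moves `y` into
`[x, x + 1]`. -/
theorem le_exp_mul (hK : 0 < K) (h : InCone K m w) (x y : ℝ) : w x ≤ Real.exp K * w y := by
  have hmono : Monotone fun t => Real.exp (K * t) * w t := by
    have hd (t : ℝ) : HasDerivAt (fun t => Real.exp (K * t) * w t)
        (Real.exp (K * t) * K * w t + Real.exp (K * t) * deriv w t) t := by
      have h1 : HasDerivAt (fun t : ℝ => K * t) K t := by
        simpa using (hasDerivAt_id t).const_mul K
      exact h1.exp.mul ((h.contDiff.differentiable one_ne_zero) t).hasDerivAt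
    refine monotone_of_deriv_nonneg (fun t => (hd t).differentiableAt) fun t => ?_
    rw [(hd t).deriv]
    have := (abs_le.1 (h.abs_deriv_le t)).1
    have h2 : 0 ≤ Real.exp (K * t) * (K * w t + deriv w t) :=
      mul_nonneg (Real.exp_pos _).le (by linarith)
    linarith
  have hy : w (y + ⌈x - y⌉) = w y := by simpa using h.periodic.int_mul ⌈x - y⌉ y
  have hle : x ≤ y + ⌈x - y⌉ := by linarith [Int.le_ceil (x - y)]
  have hlt : y + ⌈x - y⌉ ≤ x + 1 := by linarith [Int.ceil_lt_add_one (x - y)]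
  have h1 := hmono hle
  simp only [hy] at h1
  have h2 : Real.exp (K * (y + ⌈x - y⌉)) * w y ≤ Real.exp (K * x) * (Real.exp K * w y) := by
    rw [← mul_assoc, ← Real.exp_add]
    refine mul_le_mul_of_nonneg_right (Real.exp_le_exp.2 ?_) (h.nonneg hK y)
    nlinarith
  exact le_of_mul_le_mul_left (h1.trans h2) (Real.exp_pos _)

theorem le_exp_mul_mass (hK : 0 < K) (h : InCone K m w) (x : ℝ) : w x ≤ Real.exp K * m := by
  have := intervalIntegral.integral_mono_on (μ := volume) (a := 0) (b := 1)
    (f := fun _ => w x) (g := fun y => Real.exp K * w y) zero_le_one (by simp)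
    ((continuous_const.mul h.contDiff.continuous).intervalIntegrable _ _)
    fun y _ => h.le_exp_mul hK x y
  simpa [h.integral_eq] using this

theorem mass_le_exp_mul (hK : 0 < K) (h : InCone K m w) (y : ℝ) : m ≤ Real.exp K * w y := by
  have := intervalIntegral.integral_mono_on (μ := volume) (a := 0) (b := 1)
    (f := w) (g := fun _ => Real.exp K * w y) zero_le_one
    (h.contDiff.continuous.intervalIntegrable _ _) (by simp)
    fun x _ => h.le_exp_mul hK x y
  simpa [h.integral_eq] using this

end InCone

/-- An aperture `K` of the cone for which `lam * K + D + (1 - lam) ≤ K`, so that the transfer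
operator maps the cone strictly inside itself. -/
noncomputable def coneConst (lam D : ℝ) : ℝ := 2 * D / (1 - lam) + 1

/-- The rate at which the transfer operator contracts differences of cone elements of equal mass:
`1 - α`, where the constant `α m` can be split off the image of every cone element of mass `m`. -/
noncomputable def contractionRate (lam D : ℝ) : ℝ :=
  1 - Real.exp (-coneConst lam D) * (1 - lam) / coneConst lam D

/-- The constant in the exponential decay of the iterates on mean-zero functions. -/
noncomputable def decayConst (lam D : ℝ) : ℝ :=
  4 * coneConst lam D * Real.exp (coneConst lam D)

theorem sum_pow_sub {E : Type*} [AddCommGroup E] [Module ℝ E] (A : Module.End ℝ E) {u f : E}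
    (huf : u - A u = f) (N : ℕ) : ∑ n ∈ Finset.range N, (A ^ n) f + (A ^ N) u = u := by
  induction N with
  | zero => simp
  | succ N ih =>
    have : (A ^ N) u = (A ^ N) f + (A ^ (N + 1)) u := by
      rw [← huf, map_sub, pow_succ, Module.End.mul_apply]; abel
    rw [Finset.sum_range_succ, add_assoc, ← this, ih]

theorem contDiff_one_tsum {u : ℕ → ℝ → ℝ} {v : ℕ → ℝ} (hv : Summable v)
    (hu : ∀ n, ContDiff ℝ 1 (u n)) (h0 : ∀ n x, |u n x| ≤ v n) (h1 : ∀ n x, |deriv (u n) x| ≤ v n) :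
    ContDiff ℝ 1 (fun x => ∑' n, u n x) := by
  have hd (y : ℝ) : HasDerivAt (fun x => ∑' n, u n x) (∑' n, deriv (u n) y) y :=
    hasDerivAt_tsum hv (fun n y => ((hu n).differentiable one_ne_zero y).hasDerivAt) h1
      (Summable.of_norm_bounded hv fun n => h0 n 0) y
  refine contDiff_one_iff_deriv.2 ⟨fun y => (hd y).differentiableAt, ?_⟩
  rw [show deriv (fun x => ∑' n, u n x) = fun y => ∑' n, deriv (u n) y from
    funext fun y => (hd y).deriv]
  exact continuous_tsum (fun n => (hu n).continuous_deriv le_rfl) hv h1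

namespace ExpandingLift

variable {r d : ℕ} {lam D : ℝ} {F g : ℝ → ℝ}

theorem one_le_coneConst (h : ExpandingLift r d lam D F g) : 1 ≤ coneConst lam D := by
  have h1 := h.lam_lt_one
  have h2 := h.D_nonneg
  have : 0 ≤ 2 * D / (1 - lam) := div_nonneg (by linarith) (by linarith)
  unfold coneConst; linarith

theorem contractionRate_lt_one (h : ExpandingLift r d lam D F g) : contractionRate lam D < 1 := by
  have h1 := h.lam_lt_one
  have h2 := h.one_le_coneConst
  have : 0 < Real.exp (-coneConst lam D) * (1 - lam) / coneConst lam D :=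
    div_pos (mul_pos (Real.exp_pos _) (by linarith)) (by linarith)
  unfold contractionRate; linarith

theorem contractionRate_nonneg (h : ExpandingLift r d lam D F g) : 0 ≤ contractionRate lam D := by
  have h1 := h.lam_pos
  have h3 := h.lam_lt_one
  have h2 := h.one_le_coneConst
  have : Real.exp (-coneConst lam D) * (1 - lam) / coneConst lam D ≤ 1 := by
    rw [div_le_one (by linarith)]
    have : Real.exp (-coneConst lam D) ≤ 1 := Real.exp_le_one_iff.2 (by linarith)
    nlinarith
  unfold contractionRate; linarith

theorem abs_deriv_branchSum_le (h : ExpandingLift r d lam D F g) {K m : ℝ} {w : ℝ → ℝ}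
    (hK : 0 < K) (hw : InCone K m w) (x : ℝ) :
    |deriv (branchSum F g d w) x| ≤ (lam * K + D) * branchSum F g d w x := by
  rw [h.deriv_branchSum hw.contDiff]
  have ha := (h.contDiff_inv_deriv (m := 1) h.two_le_smoothness).differentiable one_ne_zero
  have hd := hw.contDiff.differentiable one_ne_zero
  refine (h.abs_branchSum_le (v := (lam * K + D) • w) (fun y => ?_) x).trans_eq
    (by rw [map_smul]; rfl)
  rw [deriv_fun_mul (ha y) (hd y), Pi.smul_apply, smul_eq_mul]
  refine (abs_add_le _ _).trans ?_
  rw [abs_mul, abs_mul, abs_of_nonneg (h.inv_deriv_nonneg y), abs_of_nonneg (hw.nonneg hK y)]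
  have h1 := mul_le_mul_of_nonneg_right (h.abs_deriv_inv_le y) (hw.nonneg hK y)
  have h2 := mul_le_mul (h.inv_deriv_le y) (hw.abs_deriv_le y) (abs_nonneg _) h.lam_pos.le
  linarith

/-- The image of a cone element is so far inside the cone that the constant `α m`, where `α` is
one minus the contraction rate, can be subtracted without leaving it. -/
theorem branchSum_mem_cone (h : ExpandingLift r d lam D F g) {m : ℝ} {w : ℝ → ℝ}
    (hw : InCone (coneConst lam D) m w) :
    InCone (coneConst lam D) m (branchSum F g d w) ∧
      InCone (coneConst lam D) (contractionRate lam D * m)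
        (fun x => branchSum F g d w x - (1 - contractionRate lam D) * m) := by
  set K := coneConst lam D with hK
  have hK1 : 1 ≤ K := h.one_le_coneConst
  have hK0 : 0 < K := by linarith
  have hl := h.lam_lt_one
  have hgap : lam * K + D + (1 - lam) ≤ K := by
    have : (1 - lam) * K = 2 * D + (1 - lam) := by
      rw [hK, coneConst, mul_add, mul_div_cancel₀ _ (by linarith), mul_one]
    linarith [h.D_nonneg]
  have hL0 (x : ℝ) : 0 ≤ branchSum F g d w x := by
    have := h.branchSum_mono (u := 0) (hw.nonneg hK0) x
    rwa [map_zero] at this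
  have hC1 := h.contDiff_branchSum (m := 1) h.two_le_smoothness hw.contDiff
  have hint := (h.integral_branchSum hw.periodic (hw.contDiff.continuous.intervalIntegrable _ _)).2
  have hmem : InCone K m (branchSum F g d w) := by
    refine ⟨hC1, h.branchSum_periodic hw.periodic, fun x => ?_, hint.trans hw.integral_eq⟩
    exact (h.abs_deriv_branchSum_le hK0 hw x).trans
      (mul_le_mul_of_nonneg_right (by linarith) (hL0 x))
  refine ⟨hmem, hC1.sub contDiff_const, fun x => ?_, fun x => ?_, ?_⟩
  · simp only [h.branchSum_periodic hw.periodic x]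
  · rw [deriv_sub_const]
    refine (h.abs_deriv_branchSum_le hK0 hw x).trans ?_
    have h1 : Real.exp (-K) * m ≤ branchSum F g d w x := by
      rw [Real.exp_neg, inv_mul_le_iff₀ (Real.exp_pos _)]
      exact hmem.mass_le_exp_mul hK0 x
    have h2 : K * ((1 - contractionRate lam D) * m) = (1 - lam) * (Real.exp (-K) * m) := by
      rw [contractionRate, ← hK]; field_simp; ring
    have h3 := mul_le_mul_of_nonneg_left h1 (by linarith : 0 ≤ 1 - lam)
    have h4 := mul_le_mul_of_nonneg_right hgap (hL0 x)
    rw [mul_sub, h2]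
    linarith
  · rw [intervalIntegral.integral_sub (hC1.continuous.intervalIntegrable _ _) (by simp), hint,
      hw.integral_eq]
    simp
    ring

/-- The constants split off from two cone elements of equal mass cancel in the difference, so the
difference of their images under `L^n` is one of cone elements of mass `(1 - α)^n m`. -/
theorem exists_cone_sub_eq (h : ExpandingLift r d lam D F g) {m : ℝ} {w₁ w₂ : ℝ → ℝ}
    (hw₁ : InCone (coneConst lam D) m w₁) (hw₂ : InCone (coneConst lam D) m w₂) (n : ℕ) :
    ∃ h₁ h₂, InCone (coneConst lam D) (contractionRate lam D ^ n * m) h₁ ∧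
      InCone (coneConst lam D) (contractionRate lam D ^ n * m) h₂ ∧
      (branchSum F g d ^ n) (w₁ - w₂) = h₁ - h₂ := by
  induction n with
  | zero => exact ⟨w₁, w₂, by simpa using hw₁, by simpa using hw₂, by simp⟩
  | succ n ih =>
    obtain ⟨h₁, h₂, hh₁, hh₂, he⟩ := ih
    refine ⟨_, _, by rw [pow_succ', mul_assoc]; exact (h.branchSum_mem_cone hh₁).2,
      by rw [pow_succ', mul_assoc]; exact (h.branchSum_mem_cone hh₂).2, ?_⟩
    rw [pow_succ', Module.End.mul_apply, he, map_sub]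
    ext x
    simp

theorem one_mem_cone (h : ExpandingLift r d lam D F g) : InCone (coneConst lam D) 1 1 :=
  ⟨contDiff_const, fun _ => rfl, fun x => by
    have := h.one_le_coneConst
    have h1 : deriv (1 : ℝ → ℝ) x = 0 := deriv_const x 1
    rw [h1]; simp; linarith, by simp⟩

theorem pow_one_mem_cone (h : ExpandingLift r d lam D F g) (n : ℕ) :
    InCone (coneConst lam D) 1 ((branchSum F g d ^ n) 1) := by
  induction n with
  | zero => simpa using h.one_mem_cone
  | succ n ih => rw [pow_succ', Module.End.mul_apply]; exact (h.branchSum_mem_cone ih).1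

theorem abs_pow_le (h : ExpandingLift r d lam D F g) {f : ℝ → ℝ} {s : ℝ}
    (hf : ∀ x, |f x| ≤ s) (n : ℕ) (x : ℝ) :
    |(branchSum F g d ^ n) f x| ≤ Real.exp (coneConst lam D) * s := by
  have key : ∀ x, |(branchSum F g d ^ n) f x| ≤ (s • (branchSum F g d ^ n) 1) x := by
    induction n with
    | zero => intro x; simpa using hf x
    | succ n ih =>
      intro x
      rw [pow_succ', Module.End.mul_apply, Module.End.mul_apply, ← map_smul]
      exact h.abs_branchSum_le ih x
  have hs : 0 ≤ s := (abs_nonneg _).trans (hf 0)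
  refine (key x).trans ?_
  rw [Pi.smul_apply, smul_eq_mul, mul_comm]
  have := (h.pow_one_mem_cone n).le_exp_mul_mass (by linarith [h.one_le_coneConst]) x
  exact mul_le_mul_of_nonneg_right (by simpa using this) hs

/-- Exponential decay in `C^1` of the iterates on mean-zero functions, with constants depending
only on `lam` and `D`. -/
theorem decay (h : ExpandingLift r d lam D F g) {f : ℝ → ℝ} {B : ℝ} (hf : ContDiff ℝ 1 f)
    (hp : Function.Periodic f 1) (hm : ∫ x in (0 : ℝ)..1, f x = 0) (hB : ∀ x, |f x| ≤ B)
    (hB' : ∀ x, |deriv f x| ≤ B) (n : ℕ) (x : ℝ) :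
    |(branchSum F g d ^ n) f x| ≤ decayConst lam D * B * contractionRate lam D ^ n ∧
      |deriv ((branchSum F g d ^ n) f) x| ≤ decayConst lam D * B * contractionRate lam D ^ n := by
  set K := coneConst lam D with hK
  have hK1 : 1 ≤ K := h.one_le_coneConst
  have hK0 : 0 < K := by linarith
  have hB0 : 0 ≤ B := (abs_nonneg _).trans (hB 0)
  -- `f` is the difference of the cone elements `f + 2 B` and `2 B`
  have h1 : InCone K (2 * B) (fun x => f x + 2 * B) := by
    refine ⟨hf.add contDiff_const, fun x => by simp only [hp x], fun x => ?_, ?_⟩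
    · rw [deriv_add_const]
      have := (abs_le.1 (hB x)).1
      nlinarith [hB' x]
    · rw [intervalIntegral.integral_add (hf.continuous.intervalIntegrable _ _) (by simp), hm]
      simp
  have h2 : InCone K (2 * B) (fun _ => 2 * B) :=
    ⟨contDiff_const, fun _ => rfl, fun x => by rw [deriv_const]; simp; positivity, by simp⟩
  obtain ⟨u, v, hu, hv, he⟩ := h.exists_cone_sub_eq h1 h2 n
  have hfe : f = (fun x => f x + 2 * B) - (fun _ => 2 * B) := by ext x; simp
  set θ := contractionRate lam D ^ n with hθ
  have hθ0 : 0 ≤ θ := pow_nonneg h.contractionRate_nonneg _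
  rw [← hfe] at he
  rw [he]
  have hu0 := hu.nonneg hK0 x
  have hv0 := hv.nonneg hK0 x
  have hu1 := hu.le_exp_mul_mass hK0 x
  have hv1 := hv.le_exp_mul_mass hK0 x
  have hP : 0 ≤ Real.exp K * (θ * (2 * B)) := by positivity
  have hdc : decayConst lam D * B * θ = 2 * K * (Real.exp K * (θ * (2 * B))) := by
    rw [decayConst, ← hK]; ring
  rw [hdc]
  constructor
  · rw [Pi.sub_apply, abs_le]
    constructor <;> nlinarith
  · rw [deriv_sub (hu.contDiff.differentiable one_ne_zero x)
      (hv.contDiff.differentiable one_ne_zero x)]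
    refine (abs_sub _ _).trans ?_
    have a1 := (hu.abs_deriv_le x).trans (mul_le_mul_of_nonneg_left hu1 hK0.le)
    have a2 := (hv.abs_deriv_le x).trans (mul_le_mul_of_nonneg_left hv1 hK0.le)
    linarith

theorem decayConst_nonneg (h : ExpandingLift r d lam D F g) : 0 ≤ decayConst lam D := by
  have := h.one_le_coneConst
  unfold decayConst; positivity

theorem pow_contDiff (h : ExpandingLift r d lam D F g) {f : ℝ → ℝ} (hf : ContDiff ℝ 1 f) (n : ℕ) :
    ContDiff ℝ 1 ((branchSum F g d ^ n) f) := by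
  induction n with
  | zero => simpa using hf
  | succ n ih =>
    rw [pow_succ', Module.End.mul_apply]
    exact h.contDiff_branchSum (m := 1) h.two_le_smoothness ih

theorem pow_periodic (h : ExpandingLift r d lam D F g) {f : ℝ → ℝ}
    (hf : Function.Periodic f 1) (n : ℕ) : Function.Periodic ((branchSum F g d ^ n) f) 1 := by
  induction n with
  | zero => simpa using hf
  | succ n ih => rw [pow_succ', Module.End.mul_apply]; exact h.branchSum_periodic ih

/-- Quantitative inversion of `1 - L` on mean-zero functions. In the Neumann series for `u`, the
first `N` terms are controlled by the supremum `s` of `f` and the others by its `C^1` norm, so `u`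
is small as soon as `f` is uniformly small and bounded in `C^1`. -/
theorem abs_le_of_sub_branchSum (h : ExpandingLift r d lam D F g) {u f : ℝ → ℝ} {s B : ℝ}
    (hu : ContDiff ℝ 1 u) (hp : Function.Periodic u 1) (hm : ∫ x in (0 : ℝ)..1, u x = 0)
    (huf : u - branchSum F g d u = f) (hs : ∀ x, |f x| ≤ s) (hB : ∀ x, |f x| ≤ B)
    (hB' : ∀ x, |deriv f x| ≤ B) (N : ℕ) (x : ℝ) :
    |u x| ≤ N * (Real.exp (coneConst lam D) * s) +
      decayConst lam D * B * contractionRate lam D ^ N * (1 - contractionRate lam D)⁻¹ := by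
  have hf : ContDiff ℝ 1 f := huf ▸ hu.sub (h.contDiff_branchSum (m := 1) h.two_le_smoothness hu)
  have hfp : Function.Periodic f 1 := huf ▸ hp.sub (h.branchSum_periodic hp)
  have hui := hu.continuous.intervalIntegrable (μ := volume) 0 1
  have hfm : ∫ x in (0 : ℝ)..1, f x = 0 := by
    obtain ⟨h1, h2⟩ := h.integral_branchSum hp hui
    rw [← huf]
    simp only [Pi.sub_apply]
    rw [intervalIntegral.integral_sub hui h1, h2, sub_self]
  obtain ⟨B₁, hB₁, hb₁⟩ := exists_abs_le_of_periodic hp hu.continuous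
  obtain ⟨B₂, hB₂, hb₂⟩ := exists_abs_le_of_periodic (periodic_deriv_of_periodic hp)
    (hu.continuous_deriv le_rfl)
  set θ := contractionRate lam D with hθ
  have hθ0 : 0 ≤ θ := h.contractionRate_nonneg
  have hθ1 : θ < 1 := h.contractionRate_lt_one
  have hB0 : 0 ≤ B := (abs_nonneg _).trans (hB 0)
  have hC0 := h.decayConst_nonneg
  have hlim : Tendsto (fun j : ℕ => N * (Real.exp (coneConst lam D) * s) +
      decayConst lam D * B * θ ^ N * (1 - θ)⁻¹ + decayConst lam D * (max B₁ B₂) * θ ^ (N + j))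
      atTop (𝓝 (N * (Real.exp (coneConst lam D) * s) +
        decayConst lam D * B * θ ^ N * (1 - θ)⁻¹ + decayConst lam D * (max B₁ B₂) * 0)) := by
    refine Tendsto.const_add _ (Tendsto.const_mul _ ?_)
    have := (tendsto_pow_atTop_nhds_zero_of_lt_one hθ0 hθ1)
    exact this.comp (tendsto_add_atTop_nat N |>.congr fun j => by ring)
  rw [mul_zero, add_zero] at hlim
  refine ge_of_tendsto' hlim fun j => ?_
  have hx := congrFun (sum_pow_sub (branchSum F g d) huf (N + j)) x
  rw [Finset.sum_range_add, Pi.add_apply, Pi.add_apply, Finset.sum_apply, Finset.sum_apply] at hx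
  rw [← hx]
  refine (abs_add_le _ _).trans (add_le_add ((abs_add_le _ _).trans (add_le_add ?_ ?_)) ?_)
  · refine (Finset.abs_sum_le_sum_abs _ _).trans
      ((Finset.sum_le_sum fun n _ => h.abs_pow_le hs n x).trans_eq ?_)
    simp
  · refine (Finset.abs_sum_le_sum_abs _ _).trans
      ((Finset.sum_le_sum fun n _ => (h.decay hf hfp hfm hB hB' (N + n) x).1).trans ?_)
    rw [← Finset.mul_sum]
    simp only [pow_add, ← Finset.mul_sum]
    rw [← mul_assoc]
    refine mul_le_mul_of_nonneg_left ?_ (by positivity)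
    rw [← tsum_geometric_of_lt_one hθ0 hθ1]
    exact (summable_geometric_of_lt_one hθ0 hθ1).sum_le_tsum _ fun i _ => by positivity
  · exact (h.decay hu hp hm (fun y => (hb₁ y).trans (le_max_left _ _))
      (fun y => (hb₂ y).trans (le_max_right _ _)) (N + j) x).1

/-- The fixed density is the limit of `L^N 1 = 1 + ∑ n < N, L^n (L 1 - 1)`, a series that converges
in `C^1`. -/
theorem exists_density (h : ExpandingLift r d lam D F g) :
    ∃ ρ : ℝ → ℝ, ContDiff ℝ 1 ρ ∧ Function.Periodic ρ 1 ∧ (∀ x, 0 < ρ x) ∧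
      ∫ x in (0 : ℝ)..1, ρ x = 1 ∧ branchSum F g d ρ = ρ := by
  set L := branchSum F g d with hL
  have hK0 : 0 < coneConst lam D := by linarith [h.one_le_coneConst]
  have h1 : ContDiff ℝ 1 (1 : ℝ → ℝ) := contDiff_const
  have h1p : Function.Periodic (1 : ℝ → ℝ) 1 := fun _ => rfl
  set f : ℝ → ℝ := L 1 - 1 with hf
  have hf1 : ContDiff ℝ 1 f := (h.contDiff_branchSum (m := 1) h.two_le_smoothness h1).sub h1
  have hfp : Function.Periodic f 1 := (h.branchSum_periodic h1p).sub h1p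
  have hfm : ∫ x in (0 : ℝ)..1, f x = 0 := by
    have hi : IntervalIntegrable (1 : ℝ → ℝ) volume 0 1 := h1.continuous.intervalIntegrable _ _
    obtain ⟨a1, a2⟩ := h.integral_branchSum h1p hi
    rw [hf]
    simp only [Pi.sub_apply]
    rw [intervalIntegral.integral_sub a1 hi, a2, sub_self]
  obtain ⟨B₁, hB₁, hb₁⟩ := exists_abs_le_of_periodic hfp hf1.continuous
  obtain ⟨B₂, hB₂, hb₂⟩ := exists_abs_le_of_periodic (periodic_deriv_of_periodic hfp)
    (hf1.continuous_deriv le_rfl)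
  have hdec := h.decay hf1 hfp hfm (fun y => (hb₁ y).trans (le_max_left B₁ B₂))
      (fun y => (hb₂ y).trans (le_max_right B₁ B₂))
  have hsum : Summable fun n => decayConst lam D * max B₁ B₂ * contractionRate lam D ^ n :=
    (summable_geometric_of_lt_one h.contractionRate_nonneg h.contractionRate_lt_one).mul_left _
  set ρ : ℝ → ℝ := fun x => 1 + ∑' n, (L ^ n) f x with hρ
  have htel (N : ℕ) : 1 + ∑ n ∈ Finset.range N, (L ^ n) f = (L ^ N) 1 := by
    have := sum_pow_sub L (u := (1 : ℝ → ℝ)) (f := -f) (by rw [hf]; abel) N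
    simp only [map_neg, Finset.sum_neg_distrib] at this
    nth_rw 1 [← this]; abel
  have hlim (x : ℝ) : Tendsto (fun N => (L ^ N) 1 x) atTop (𝓝 (ρ x)) := by
    have hs : Summable fun n => (L ^ n) f x :=
      Summable.of_norm_bounded hsum fun n => (hdec n x).1
    refine (hs.hasSum.tendsto_sum_nat.const_add 1).congr fun N => ?_
    rw [← htel N]; simp
  have hlow (x : ℝ) : (Real.exp (coneConst lam D))⁻¹ ≤ ρ x := by
    refine ge_of_tendsto' (hlim x) fun N => ?_
    rw [inv_le_iff_one_le_mul₀' (Real.exp_pos _)]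
    exact (h.pow_one_mem_cone N).mass_le_exp_mul hK0 x
  have hcd : ContDiff ℝ 1 ρ := contDiff_const.add (contDiff_one_tsum hsum
    (fun n => h.pow_contDiff hf1 n) (fun n x => (hdec n x).1) (fun n x => (hdec n x).2))
  refine ⟨ρ, hcd, fun x => ?_, fun x => (inv_pos.2 (Real.exp_pos _)).trans_le (hlow x), ?_, ?_⟩
  · exact tendsto_nhds_unique ((hlim (x + 1)).congr fun N => h.pow_periodic h1p N x) (hlim x)
  · have hT : Tendsto (fun N => ∫ x in (0 : ℝ)..1, (L ^ N) 1 x) atTop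
        (𝓝 (∫ x in (0 : ℝ)..1, ρ x)) := by
      refine intervalIntegral.tendsto_integral_filter_of_dominated_convergence
        (fun _ => Real.exp (coneConst lam D) * 1) (Eventually.of_forall fun N =>
          (h.pow_one_mem_cone N).contDiff.continuous.aestronglyMeasurable)
        (Eventually.of_forall fun N => Eventually.of_forall fun x _ => ?_) (by simp)
        (Eventually.of_forall fun x _ => hlim x)
      rw [Real.norm_eq_abs, abs_of_nonneg ((h.pow_one_mem_cone N).nonneg hK0 x)]
      exact (h.pow_one_mem_cone N).le_exp_mul_mass hK0 x
    refine tendsto_nhds_unique hT (tendsto_const_nhds.congr fun N => ?_)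
    exact (h.pow_one_mem_cone N).integral_eq.symm
  · funext x
    refine tendsto_nhds_unique (tendsto_branchSum hlim x) ?_
    refine ((tendsto_add_atTop_iff_nat 1).2 (hlim x)).congr fun N => ?_
    rw [pow_succ', Module.End.mul_apply]

end ExpandingLift

/-! ### Regularity of the fixed density -/

namespace ExpandingLift

variable {r d : ℕ} {lam D : ℝ} {F g : ℝ → ℝ}

/-- A continuous solution of `v = L (b v) + f` with `|b| ≤ lam` and `b`, `f` of class `C^1` is
`C^1`. The operator `u ↦ L (b u)` contracts the norm `sup |u| / ρ` weighted by the fixed density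
`ρ`, and `(L (b u))' = L (a b u') + L ((a b)' u)` with `a = 1 / F'`, so the Neumann series
`v = ∑ n, (L b)^n f` converges in `C^1`. -/
theorem contDiff_one_of_cohomological (h : ExpandingLift r d lam D F g) {b f v : ℝ → ℝ}
    (hb : ContDiff ℝ 1 b) (hbp : Function.Periodic b 1) (hbl : ∀ x, |b x| ≤ lam)
    (hf : ContDiff ℝ 1 f) (hfp : Function.Periodic f 1)
    (hv : Continuous v) (hvp : Function.Periodic v 1)
    (hvf : v = branchSum F g d (b * v) + f) : ContDiff ℝ 1 v := by
  obtain ⟨ρ, hρc, hρp, hρ0, -, hρ⟩ := h.exists_density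
  have hl0 := h.lam_pos
  have hl1 := h.lam_lt_one
  have hdom {w : ℝ → ℝ} (hw : Continuous w) (hwp : Function.Periodic w 1) :
      ∃ c, 0 ≤ c ∧ ∀ x, |w x| ≤ c * ρ x := by
    obtain ⟨c, hc, hc'⟩ := exists_abs_le_of_periodic (w := fun x => w x / ρ x)
      (fun x => by simp only [hwp x, hρp x]) (hw.div hρc.continuous fun x => (hρ0 x).ne')
    refine ⟨c, hc.le, fun x => ?_⟩
    have := hc' x
    rwa [abs_div, abs_of_pos (hρ0 x), div_le_iff₀ (hρ0 x)] at this
  have hstep {β u : ℝ → ℝ} {s c : ℝ} (hβ : ∀ x, |β x| ≤ s)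
      (hu : ∀ x, |u x| ≤ c * ρ x) (x : ℝ) : |branchSum F g d (β * u) x| ≤ s * c * ρ x := by
    refine (h.abs_branchSum_le (v := (s * c) • ρ) (fun y => ?_) x).trans_eq
      (by rw [map_smul, hρ]; rfl)
    rw [Pi.mul_apply, abs_mul, Pi.smul_apply, smul_eq_mul, mul_assoc]
    exact mul_le_mul (hβ y) (hu y) (abs_nonneg _) ((abs_nonneg _).trans (hβ y))
  set A : Module.End ℝ (ℝ → ℝ) := branchSum F g d ∘ₗ LinearMap.mulLeft ℝ b with hA
  have hAdef (u : ℝ → ℝ) : A u = branchSum F g d (b * u) := rfl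
  have ha := h.contDiff_inv_deriv (m := 1) h.two_le_smoothness
  set β : ℝ → ℝ := fun y => (deriv F y)⁻¹ * b y with hβdef
  have hβ1 : ContDiff ℝ 1 β := ha.mul hb
  have hβp : Function.Periodic β 1 := h.inv_deriv_periodic.mul hbp
  have hβl (x : ℝ) : |β x| ≤ lam := by
    rw [hβdef, abs_mul, abs_of_nonneg (h.inv_deriv_nonneg x)]
    have := mul_le_mul (h.inv_deriv_le x) (hbl x) (abs_nonneg _) hl0.le
    nlinarith
  obtain ⟨C, hC, hβC⟩ := exists_abs_le_of_periodic (periodic_deriv_of_periodic hβp)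
    (hβ1.continuous_deriv le_rfl)
  obtain ⟨c, hc, hfc⟩ := hdom hf.continuous hfp
  obtain ⟨e, he, hfe⟩ := hdom (hf.continuous_deriv le_rfl) (periodic_deriv_of_periodic hfp)
  obtain ⟨k, hk, hvk⟩ := hdom hv hvp
  obtain ⟨R, hR, hρR⟩ := exists_abs_le_of_periodic hρp hρc.continuous
  -- any rate strictly between `lam` and `1` absorbs the off-diagonal term
  set θ := (1 + lam) / 2 with hθ
  have hθl : lam < θ := by rw [hθ]; linarith
  have hθ1 : θ < 1 := by rw [hθ]; linarith
  have hθ0 : 0 < θ := hl0.trans hθl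
  set E := e + C * c / (θ - lam) with hE
  have hE0 : 0 ≤ E := add_nonneg he (div_nonneg (by positivity) (by linarith))
  have hEe : C * c + lam * E ≤ θ * E := by
    have : C * c / (θ - lam) * (θ - lam) = C * c := div_mul_cancel₀ _ (by linarith)
    have h2 : 0 ≤ e * (θ - lam) := mul_nonneg he (by linarith)
    have h3 : E * (θ - lam) = e * (θ - lam) + C * c := by rw [hE, add_mul, this]
    linarith
  have hbound (n : ℕ) : ContDiff ℝ 1 ((A ^ n) f) ∧ (∀ x, |(A ^ n) f x| ≤ c * θ ^ n * ρ x) ∧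
      ∀ x, |deriv ((A ^ n) f) x| ≤ E * θ ^ n * ρ x := by
    induction n with
    | zero =>
      refine ⟨by simpa using hf, by simpa using hfc, fun x => ?_⟩
      have : e ≤ E := le_add_of_nonneg_right (div_nonneg (by positivity) (by linarith))
      simpa using (hfe x).trans (mul_le_mul_of_nonneg_right this (hρ0 x).le)
    | succ n ih =>
      obtain ⟨i1, i2, i3⟩ := ih
      rw [pow_succ', Module.End.mul_apply, hAdef]
      have hbu : ContDiff ℝ 1 (b * (A ^ n) f) := hb.mul i1
      refine ⟨h.contDiff_branchSum (m := 1) h.two_le_smoothness hbu, fun x => ?_, fun x => ?_⟩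
      · refine (hstep hbl i2 x).trans (mul_le_mul_of_nonneg_right ?_ (hρ0 x).le)
        rw [pow_succ]
        have : 0 ≤ c * θ ^ n := by positivity
        nlinarith
      · have hder : (deriv fun y => (deriv F y)⁻¹ * (b * (A ^ n) f) y) =
            deriv β * (A ^ n) f + β * deriv ((A ^ n) f) := by
          funext y
          rw [show (fun y => (deriv F y)⁻¹ * (b * (A ^ n) f) y) = fun y => β y * (A ^ n) f y from
            funext fun y => by rw [Pi.mul_apply, hβdef]; ring]
          rw [deriv_fun_mul (hβ1.differentiable one_ne_zero y) (i1.differentiable one_ne_zero y)]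
          rfl
        rw [h.deriv_branchSum hbu, hder, map_add, Pi.add_apply]
        refine (abs_add_le _ _).trans ((add_le_add (hstep hβC i2 x) (hstep hβl i3 x)).trans ?_)
        rw [← add_mul, pow_succ]
        refine mul_le_mul_of_nonneg_right ?_ (hρ0 x).le
        have := mul_le_mul_of_nonneg_right hEe (pow_nonneg hθ0.le n)
        linarith
  have hρR' (x : ℝ) : ρ x ≤ R := (le_abs_self _).trans (hρR x)
  have hsum : Summable fun n => max c E * R * θ ^ n :=
    (summable_geometric_of_lt_one hθ0.le hθ1).mul_left _
  have hle {y : ℝ} (hy0 : 0 ≤ y) (hy : y ≤ max c E) (n : ℕ) (x : ℝ) :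
      y * θ ^ n * ρ x ≤ max c E * R * θ ^ n := by
    have h1 := mul_le_mul hy (hρR' x) (hρ0 x).le (hy0.trans hy)
    have := mul_le_mul_of_nonneg_right h1 (pow_nonneg hθ0.le n)
    linarith
  have hb0 (n : ℕ) (x : ℝ) : |(A ^ n) f x| ≤ max c E * R * θ ^ n :=
    ((hbound n).2.1 x).trans (hle hc (le_max_left _ _) n x)
  have hb1 (n : ℕ) (x : ℝ) : |deriv ((A ^ n) f) x| ≤ max c E * R * θ ^ n :=
    ((hbound n).2.2 x).trans (hle hE0 (le_max_right _ _) n x)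
  have hrem (n : ℕ) (x : ℝ) : |(A ^ n) v x| ≤ k * θ ^ n * ρ x := by
    induction n generalizing x with
    | zero => simpa using hvk x
    | succ n ih =>
      rw [pow_succ', Module.End.mul_apply, hAdef]
      refine (hstep hbl ih x).trans (mul_le_mul_of_nonneg_right ?_ (hρ0 x).le)
      rw [pow_succ]
      have : 0 ≤ k * θ ^ n := by positivity
      nlinarith
  have hveq : v = fun x => ∑' n, (A ^ n) f x := by
    funext x
    have hs : Summable fun n => (A ^ n) f x := Summable.of_norm_bounded hsum fun n => hb0 n x
    refine tendsto_nhds_unique ?_ hs.hasSum.tendsto_sum_nat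
    have hvA : v - A v = f := by rw [hAdef]; nth_rw 1 [hvf]; abel
    have h0 : Tendsto (fun n => (A ^ n) v x) atTop (𝓝 0) := by
      refine squeeze_zero_norm (hrem · x) ?_
      have := ((tendsto_pow_atTop_nhds_zero_of_lt_one hθ0.le hθ1).const_mul k).mul_const (ρ x)
      simpa using this
    have h1 := (tendsto_const_nhds (x := v x)).sub h0
    rw [sub_zero] at h1
    refine h1.congr fun N => ?_
    have := congrFun (sum_pow_sub A hvA N) x
    rw [Pi.add_apply, Finset.sum_apply] at this
    linarith
  rw [hveq]
  exact contDiff_one_tsum hsum (fun n => (hbound n).1) hb0 hb1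

/-- Bootstrap of `contDiff_one_of_cohomological`: the derivative of a solution solves an equation of
the same form, with multiplier `b / F'`. -/
theorem contDiff_of_cohomological (h : ExpandingLift r d lam D F g) {m : ℕ} (hm : m + 1 ≤ r)
    {b f v : ℝ → ℝ}
    (hb : ContDiff ℝ m b) (hbp : Function.Periodic b 1) (hbl : ∀ x, |b x| ≤ lam)
    (hf : ContDiff ℝ m f) (hfp : Function.Periodic f 1)
    (hv : Continuous v) (hvp : Function.Periodic v 1)
    (hvf : v = branchSum F g d (b * v) + f) : ContDiff ℝ m v := by
  induction m generalizing b f v with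
  | zero => exact contDiff_zero.2 hv
  | succ m ih =>
    have hle1 : (1 : WithTop ℕ∞) ≤ (m + 1 : ℕ) := by norm_cast; omega
    have hlem : (m : WithTop ℕ∞) ≤ (m + 1 : ℕ) := by norm_cast; omega
    have hv1 := h.contDiff_one_of_cohomological (hb.of_le hle1) hbp hbl (hf.of_le hle1) hfp hv hvp
      hvf
    have hvm := ih (by omega) (hb.of_le hlem) hbp hbl (hf.of_le hlem) hfp hv hvp hvf
    set β : ℝ → ℝ := fun y => (deriv F y)⁻¹ * b y with hβdef
    have hβm : ContDiff ℝ (m + 1 : ℕ) β := (h.contDiff_inv_deriv hm).mul hb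
    have hβp : Function.Periodic β 1 := h.inv_deriv_periodic.mul hbp
    have hβl (x : ℝ) : |β x| ≤ lam := by
      rw [hβdef, abs_mul, abs_of_nonneg (h.inv_deriv_nonneg x)]
      have := mul_le_mul (h.inv_deriv_le x) (hbl x) (abs_nonneg _) h.lam_pos.le
      have := h.lam_pos
      have := h.lam_lt_one
      nlinarith
    have hβ' : ContDiff ℝ m (deriv β) := (contDiff_succ_iff_deriv.1 (by exact_mod_cast hβm)).2.2
    have hf' : ContDiff ℝ m (deriv f) := (contDiff_succ_iff_deriv.1 (by exact_mod_cast hf)).2.2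
    have hder : deriv v = branchSum F g d (β * deriv v) +
        (branchSum F g d (deriv β * v) + deriv f) := by
      have hbv : ContDiff ℝ 1 (b * v) := (hb.of_le hle1).mul hv1
      have hL := h.contDiff_branchSum (m := 1) h.two_le_smoothness hbv
      nth_rw 1 [hvf]
      have : deriv (branchSum F g d (b * v) + f) = deriv (branchSum F g d (b * v)) + deriv f :=
        funext fun x => deriv_add (hL.differentiable one_ne_zero x)
          ((hf.of_le hle1).differentiable one_ne_zero x)
      rw [this, h.deriv_branchSum hbv, ← add_assoc, ← map_add]
      congr 2
      funext y
      rw [show (fun y => (deriv F y)⁻¹ * (b * v) y) = fun y => β y * v y from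
        funext fun y => by rw [Pi.mul_apply, hβdef]; ring,
        deriv_fun_mul ((hβm.of_le hle1).differentiable one_ne_zero y)
          (hv1.differentiable one_ne_zero y), add_comm]
      rfl
    have hfin := ih (by omega) (hβm.of_le hlem) hβp hβl
      ((h.contDiff_branchSum (by omega) (hβ'.mul hvm)).add hf')
      ((h.branchSum_periodic ((periodic_deriv_of_periodic hβp).mul hvp)).add
        (periodic_deriv_of_periodic hfp)) (hv1.continuous_deriv le_rfl)
      (periodic_deriv_of_periodic hvp) hder
    have : ContDiff ℝ ((m : WithTop ℕ∞) + 1) v :=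
      contDiff_succ_iff_deriv.2 ⟨hv1.differentiable one_ne_zero, by simp, hfin⟩
    exact_mod_cast this

/-- The fixed density of a `C^r` expanding map is `C^(r-1)`: its derivative `v` satisfies
`v = L (a v) + L (a' ρ)` with `a = 1 / F'`. -/
theorem contDiff_density (h : ExpandingLift r d lam D F g) {ρ : ℝ → ℝ} (hρ : ContDiff ℝ 1 ρ)
    (hp : Function.Periodic ρ 1) (hfix : branchSum F g d ρ = ρ) {m : ℕ} (hm : m + 1 ≤ r) :
    ContDiff ℝ m ρ := by
  induction m with
  | zero => exact contDiff_zero.2 hρ.continuous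
  | succ m ih =>
    have ha := h.contDiff_inv_deriv hm
    have ha' : ContDiff ℝ m (deriv fun y => (deriv F y)⁻¹) :=
      (contDiff_succ_iff_deriv.1 (by exact_mod_cast ha)).2.2
    have hd : deriv ρ = branchSum F g d ((fun y => (deriv F y)⁻¹) * deriv ρ) +
        branchSum F g d ((deriv fun y => (deriv F y)⁻¹) * ρ) := by
      nth_rw 1 [← hfix]
      rw [h.deriv_branchSum hρ, ← map_add]
      congr 1
      funext y
      rw [deriv_fun_mul ((h.contDiff_inv_deriv (m := 1)
        h.two_le_smoothness).differentiable one_ne_zero y) (hρ.differentiable one_ne_zero y),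
        add_comm]
      rfl
    have := h.contDiff_of_cohomological (by omega)
      (h.contDiff_inv_deriv (m := m) (by omega)) h.inv_deriv_periodic
      (fun x => by rw [abs_of_nonneg (h.inv_deriv_nonneg x)]; exact h.inv_deriv_le x)
      (h.contDiff_branchSum (by omega) (ha'.mul (ih (by omega))))
      (h.branchSum_periodic ((periodic_deriv_of_periodic h.inv_deriv_periodic).mul hp))
      (hρ.continuous_deriv le_rfl) (periodic_deriv_of_periodic hp) hd
    have : ContDiff ℝ ((m : WithTop ℕ∞) + 1) ρ :=
      contDiff_succ_iff_deriv.2 ⟨hρ.differentiable one_ne_zero, by simp, this⟩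
    exact_mod_cast this

end ExpandingLift

/-! ### Passage to the circle and uniqueness of the density -/

/-- A continuous function with integer values is constant. -/
theorem exists_int_of_continuous {φ : ℝ → ℝ} (hφ : Continuous φ) (h : ∀ x, ∃ n : ℤ, φ x = n) :
    ∃ n : ℤ, ∀ x, φ x = n := by
  choose k hk using h
  have hkc : Continuous k := by
    rw [Int.isClosedEmbedding_coe_real.isInducing.continuous_iff]
    exact hφ.congr hk
  exact ⟨k 0, fun x => by rw [hk x, PreconnectedSpace.constant inferInstance hkc (y := 0)]⟩

theorem unitAddCircle_coe_eq_iff {x y : ℝ} :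
    (x : UnitAddCircle) = (y : UnitAddCircle) ↔ ∃ n : ℤ, x = y + n := by
  rw [← sub_eq_zero, ← AddCircle.coe_sub, AddCircle.coe_eq_zero_iff]
  refine exists_congr fun n => ?_
  rw [zsmul_one]
  constructor <;> intro h <;> linarith

theorem IsLift.exists_degree {F : ℝ → ℝ} {T : UnitAddCircle → UnitAddCircle} (hF : IsLift F T)
    (hc : Continuous F) : ∃ n : ℤ, ∀ x, F (x + 1) = F x + n := by
  obtain ⟨n, hn⟩ := exists_int_of_continuous (φ := fun x => F (x + 1) - F x) (by fun_prop)
    fun x => by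
      have : ((F (x + 1) : ℝ) : UnitAddCircle) = (F x : ℝ) := by
        rw [← hF, ← hF, AddCircle.coe_add_period]
      obtain ⟨n, hn⟩ := unitAddCircle_coe_eq_iff.1 this
      exact ⟨n, by linarith⟩
  exact ⟨n, fun x => by linarith [hn x]⟩

theorem IsLift.eq_add_int {F G : ℝ → ℝ} {T : UnitAddCircle → UnitAddCircle} (hF : IsLift F T)
    (hG : IsLift G T) (hFc : Continuous F) (hGc : Continuous G) :
    ∃ n : ℤ, ∀ x, F x = G x + n := by
  obtain ⟨n, hn⟩ := exists_int_of_continuous (φ := fun x => F x - G x) (by fun_prop)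
    fun x => by
      have : ((F x : ℝ) : UnitAddCircle) = (G x : ℝ) := by rw [← hF, ← hG]
      obtain ⟨n, hn⟩ := unitAddCircle_coe_eq_iff.1 this
      exact ⟨n, by linarith⟩
  exact ⟨n, fun x => by linarith [hn x]⟩

theorem exists_expandingLift {r : ℕ} (hr : 2 ≤ r) {F : ℝ → ℝ}
    {T : UnitAddCircle → UnitAddCircle} (hF : IsLift F T) (hc : ContDiff ℝ r F) {c : ℝ}
    (hc1 : 1 < c) (hcF : ∀ x, c ≤ deriv F x) :
    ∃ (d : ℕ) (D : ℝ) (g : ℝ → ℝ), ExpandingLift r d c⁻¹ D F g := by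
  have hd : Differentiable ℝ F := hc.differentiable (by norm_cast; omega)
  have hpos (x : ℝ) : 0 < deriv F x := by linarith [hcF x]
  have hmono : StrictMono F := strictMono_of_deriv_pos hpos
  have hmv : ∀ ⦃x y : ℝ⦄, x ≤ y → c * (y - x) ≤ F y - F x :=
    mul_sub_le_image_sub_of_le_deriv hd hcF
  obtain ⟨n, hn⟩ := hF.exists_degree hc.continuous
  have hn2 : 1 < n := by
    have h1 := hmv (zero_le_one (α := ℝ))
    have h2 := hn 0
    rw [zero_add] at h2
    have : (1 : ℝ) < n := by linarith
    exact_mod_cast this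
  obtain ⟨d, rfl⟩ := Int.eq_ofNat_of_zero_le (by omega : 0 ≤ n)
  have hsurj : Function.Surjective F := by
    refine hc.continuous.surjective ?_ ?_
    · refine tendsto_atTop_mono' _ ?_ (tendsto_atTop_add_const_right atTop (F 0) tendsto_id)
      filter_upwards [eventually_ge_atTop 0] with x hx
      have := hmv hx
      simp only [id]
      nlinarith
    · refine tendsto_atBot_mono' _ ?_ (tendsto_atBot_add_const_right atBot (F 0) tendsto_id)
      filter_upwards [eventually_le_atBot 0] with x hx
      have := hmv hx
      simp only [id]
      nlinarith
  choose g hg using hsurj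
  have hper : Function.Periodic (deriv F) 1 := fun x => by
    rw [← deriv_comp_add_const]
    simp [hn]
  have hF' : ContDiff ℝ 1 (deriv F) := by
    have : ContDiff ℝ (1 + 1) F := hc.of_le (by norm_cast)
    exact (contDiff_succ_iff_deriv.1 this).2.2
  obtain ⟨D, -, hD⟩ := exists_abs_le_of_periodic (w := deriv fun y => (deriv F y)⁻¹)
    (periodic_deriv_of_periodic fun x => by simp only [hper x])
    ((hF'.inv fun x => (hpos x).ne').continuous_deriv le_rfl)
  exact ⟨d, D, g, hr, hc, by omega, fun x => by simpa using hn x, inv_lt_one_of_one_lt₀ hc1, hpos,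
    fun x => inv_anti₀ (by linarith) (hcF x), hD, hg, fun x => hmono.injective (hg _)⟩

namespace ExpandingLift

variable {r d : ℕ} {lam D : ℝ} {F g : ℝ → ℝ}

theorem map_add_int (h : ExpandingLift r d lam D F g) (x : ℝ) (n : ℤ) :
    F (x + n) = F x + d * n := by
  have hp : Function.Periodic (fun x => F x - d * x) 1 := fun x => by
    simp only [h.map_add_one]; ring
  have := hp.int_mul n x
  simp only [mul_one] at this
  linarith

theorem inverse_add_int (h : ExpandingLift r d lam D F g) (x : ℝ) (n : ℤ) :
    g (x + d * n) = g x + n := by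
  rw [← h.left_inv (g x + n), h.map_add_int, h.right_inv]

theorem transferOperator_coe (h : ExpandingLift r d lam D F g)
    {T : UnitAddCircle → UnitAddCircle} (hF : IsLift F T) (w : UnitAddCircle → ℝ) (x : ℝ) :
    transferOperator T w (x : UnitAddCircle) =
      branchSum F g d (fun t : ℝ => w (t : UnitAddCircle)) x := by
  classical
  have hd : 0 < d := by have := h.two_le_degree; omega
  have hset : ∀ y : UnitAddCircle, T y = (x : UnitAddCircle) ↔
      y ∈ (((Finset.range d).image fun i : ℕ => ((g (x + i) : ℝ) : UnitAddCircle) :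
        Finset UnitAddCircle) : Set UnitAddCircle) := by
    intro y
    rw [Finset.mem_coe, Finset.mem_image]
    constructor
    · intro hy
      obtain ⟨t, rfl⟩ := QuotientAddGroup.mk_surjective y
      obtain ⟨n, hn⟩ := unitAddCircle_coe_eq_iff.1 ((hF t).symm.trans hy)
      have hmod := Int.emod_nonneg n (by omega : (d : ℤ) ≠ 0)
      have hlt := Int.emod_lt_of_pos n (by omega : 0 < (d : ℤ))
      refine ⟨(n % d).toNat, Finset.mem_range.2 (by omega), ?_⟩
      refine unitAddCircle_coe_eq_iff.2 ⟨-(n / d), ?_⟩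
      have hcast : (((n % d).toNat : ℕ) : ℝ) = ((n % d : ℤ) : ℝ) := by
        exact_mod_cast congrArg (Int.cast (R := ℝ)) (Int.toNat_of_nonneg hmod)
      have hdiv : (n : ℝ) = ((n % d : ℤ) : ℝ) + d * ((n / d : ℤ) : ℝ) := by
        exact_mod_cast (Int.emod_add_mul_ediv n d).symm
      rw [hcast, ← h.left_inv t, hn, hdiv, ← add_assoc, h.inverse_add_int]
      push_cast
      ring
    · rintro ⟨i, -, rfl⟩
      rw [hF, h.right_inv]
      exact unitAddCircle_coe_eq_iff.2 ⟨i, by simp⟩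
  have hinj : Set.InjOn (fun i : ℕ => ((g (x + i) : ℝ) : UnitAddCircle)) (Finset.range d) := by
    intro i hi j hj hij
    obtain ⟨n, hn⟩ := unitAddCircle_coe_eq_iff.1 hij
    have h1 := congrArg F hn
    rw [h.right_inv, h.map_add_int, h.right_inv] at h1
    have h2 : (i : ℤ) = j + d * n := by
      have : (i : ℝ) = j + d * n := by linarith
      exact_mod_cast this
    have hi' := Finset.mem_range.1 (Finset.mem_coe.1 hi)
    have hj' := Finset.mem_range.1 (Finset.mem_coe.1 hj)
    have h3 : (i : ℤ) % d = (j : ℤ) % d := by rw [h2, Int.add_mul_emod_self_left]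
    rw [Int.emod_eq_of_lt (by omega) (by omega), Int.emod_eq_of_lt (by omega) (by omega)] at h3
    exact_mod_cast h3
  unfold transferOperator
  simp only [hset]
  rw [finsum_mem_coe_finset, Finset.sum_image hinj, branchSum_apply]
  refine Finset.sum_congr rfl fun i _ => ?_
  rw [circleDeriv_eq_deriv_lift hF h.differentiable, div_eq_inv_mul]

theorem integral_abs_branchSum_le (h : ExpandingLift r d lam D F g) {w : ℝ → ℝ}
    (hw : Function.Periodic w 1) (hi : IntervalIntegrable w volume 0 1) :
    ∫ x in (0 : ℝ)..1, |branchSum F g d w x| ≤ ∫ x in (0 : ℝ)..1, |w x| := by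
  have hwa : Function.Periodic (fun x => |w x|) 1 := fun x => by simp only [hw x]
  obtain ⟨h1, h2⟩ := h.integral_branchSum hwa hi.abs
  rw [← h2]
  exact intervalIntegral.integral_mono_on zero_le_one (h.integral_branchSum hw hi).1.abs h1
    fun x _ => h.abs_branchSum_le (fun y => le_rfl) x

theorem integral_abs_pow_branchSum_le (h : ExpandingLift r d lam D F g) {w : ℝ → ℝ}
    (hw : Function.Periodic w 1) (hi : IntervalIntegrable w volume 0 1) (n : ℕ) :
    IntervalIntegrable ((branchSum F g d ^ n) w) volume 0 1 ∧
    ∫ x in (0 : ℝ)..1, |(branchSum F g d ^ n) w x| ≤ ∫ x in (0 : ℝ)..1, |w x| := by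
  induction n with
  | zero => simpa using hi
  | succ n ih =>
    rw [pow_succ', Module.End.mul_apply]
    exact ⟨(h.integral_branchSum (h.pow_periodic hw n) ih.1).1,
      (h.integral_abs_branchSum_le (h.pow_periodic hw n) ih.1).trans ih.2⟩

end ExpandingLift

/-- Continuous functions on the circle are uniform limits of the `C^1` averages
`s⁻¹ * ∫ y in x..x + s, φ y`. -/
theorem exists_contDiff_one_abs_sub_le {φ : UnitAddCircle → ℝ} (hφ : Continuous φ) {e : ℝ}
    (he : 0 < e) : ∃ f : ℝ → ℝ, ContDiff ℝ 1 f ∧ Function.Periodic f 1 ∧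
      ∀ x : ℝ, |φ (x : UnitAddCircle) - f x| ≤ e := by
  set p : ℝ → ℝ := fun x => φ (x : UnitAddCircle) with hpdef
  have hp : Function.Periodic p 1 := fun x => by simp only [hpdef, AddCircle.coe_add_period]
  have hc : Continuous p := hφ.comp (AddCircle.continuous_mk' 1)
  have huc : UniformContinuous p :=
    (CompactSpace.uniformContinuous_of_continuous hφ).comp
      (uniformContinuous_addMonoidHom_of_continuous
        (f := QuotientAddGroup.mk' (AddSubgroup.zmultiples (1 : ℝ))) (AddCircle.continuous_mk' 1))
  obtain ⟨t, ht, htp⟩ := Metric.uniformContinuous_iff.1 huc e he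
  set s := t / 2 with hs
  have hs0 : 0 < s := by positivity
  set P : ℝ → ℝ := fun x => ∫ y in (0 : ℝ)..x, p y with hP
  have hii (x y : ℝ) : IntervalIntegrable p volume x y := hc.intervalIntegrable _ _
  have hPd (x : ℝ) : HasDerivAt P (p x) x := by
    exact intervalIntegral.integral_hasDerivAt_right (hii 0 x)
      hc.aestronglyMeasurable.stronglyMeasurableAtFilter hc.continuousAt
  have hPsub (x : ℝ) : P (x + s) - P x = ∫ y in x..x + s, p y :=
    intervalIntegral.integral_interval_sub_left (hii _ _) (hii _ _)
  have hd (x : ℝ) : HasDerivAt (fun x => s⁻¹ * (P (x + s) - P x)) (s⁻¹ * (p (x + s) - p x)) x :=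
    (((hPd (x + s)).comp_add_const x s).sub (hPd x)).const_mul _
  refine ⟨fun x => s⁻¹ * (P (x + s) - P x), ?_, fun x => ?_, fun x => ?_⟩
  · refine contDiff_one_iff_deriv.2 ⟨fun x => (hd x).differentiableAt, ?_⟩
    rw [show deriv (fun x => s⁻¹ * (P (x + s) - P x)) = fun x => s⁻¹ * (p (x + s) - p x) from
      funext fun x => (hd x).deriv]
    fun_prop
  · simp only [hPsub]
    rw [show x + 1 + s = (x + s) + 1 by ring, ← intervalIntegral.integral_comp_add_right]
    simp only [hp _]
  · have h1 : p x - s⁻¹ * (P (x + s) - P x) = s⁻¹ * ∫ y in x..x + s, (p x - p y) := by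
      rw [intervalIntegral.integral_sub (by simp) (hii _ _), hPsub, intervalIntegral.integral_const,
        add_sub_cancel_left, smul_eq_mul, mul_sub, inv_mul_cancel_left₀ hs0.ne']
    have h2 : ‖∫ y in x..x + s, (p x - p y)‖ ≤ e * |x + s - x| := by
      refine intervalIntegral.norm_integral_le_of_norm_le_const fun y hy => ?_
      rw [Set.uIoc_of_le (by linarith)] at hy
      have := htp (a := x) (b := y) (by
        rw [Real.dist_eq, abs_sub_comm, abs_of_pos (by linarith [hy.1])]; linarith [hy.2])
      exact this.le
    rw [add_sub_cancel_left, abs_of_pos hs0, Real.norm_eq_abs] at h2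
    rw [h1, abs_mul, abs_of_pos (inv_pos.2 hs0), inv_mul_le_iff₀ hs0]
    linarith

theorem exists_contDiff_one_near {H : UnitAddCircle → ℝ} (hH : Integrable H) {e : ℝ} (he : 0 < e) :
    ∃ f : ℝ → ℝ, ContDiff ℝ 1 f ∧ Function.Periodic f 1 ∧
      ∫ x in (0 : ℝ)..1, |H (x : UnitAddCircle) - f x| ≤ e := by
  obtain ⟨φ, hφ, hφi⟩ := hH.exists_boundedContinuous_integral_sub_le (half_pos he)
  obtain ⟨f, hf1, hfp, hf⟩ := exists_contDiff_one_abs_sub_le φ.continuous (half_pos he)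
  refine ⟨f, hf1, hfp, ?_⟩
  have hsub : Integrable fun z => |H z - φ z| := (hH.sub hφi).abs
  have hi : IntervalIntegrable (fun x : ℝ => |H (x : UnitAddCircle) - φ (x : UnitAddCircle)|)
      volume 0 1 := by
    rw [intervalIntegrable_iff_integrableOn_Ioc_of_le zero_le_one]
    have := (UnitAddCircle.measurePreserving_mk 0).integrable_comp_of_integrable hsub
    rw [zero_add] at this
    exact this
  have hiH : IntervalIntegrable (fun x : ℝ => H (x : UnitAddCircle)) volume 0 1 := by
    rw [intervalIntegrable_iff_integrableOn_Ioc_of_le zero_le_one]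
    have := (UnitAddCircle.measurePreserving_mk 0).integrable_comp_of_integrable hH
    rw [zero_add] at this
    exact this
  have hint : ∫ x in (0 : ℝ)..1, |H (x : UnitAddCircle) - φ (x : UnitAddCircle)| ≤ e / 2 := by
    have := UnitAddCircle.intervalIntegral_preimage 0 fun z => |H z - φ z|
    rw [zero_add] at this
    rw [this]
    exact hφ
  calc ∫ x in (0 : ℝ)..1, |H (x : UnitAddCircle) - f x|
      ≤ ∫ x in (0 : ℝ)..1, (|H (x : UnitAddCircle) - φ (x : UnitAddCircle)| + e / 2) := by
        refine intervalIntegral.integral_mono_on zero_le_one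
          (hiH.sub (hf1.continuous.intervalIntegrable _ _)).abs (hi.add (by simp)) fun x _ => ?_
        exact (abs_sub_le _ (φ (x : UnitAddCircle)) _).trans (add_le_add le_rfl (hf x))
    _ ≤ e := by
        rw [intervalIntegral.integral_add hi (by simp)]
        simp
        linarith

namespace ExpandingLift

variable {r d : ℕ} {lam D : ℝ} {F g : ℝ → ℝ}

/-- An integrable fixed point of mean zero vanishes: approximate it in `L^1` by a `C^1` function of
mean zero, use that the transfer operator does not increase the `L^1` norm, and apply the decay of
the iterates to the approximation. -/
theorem integral_abs_eq_zero_of_fixed (h : ExpandingLift r d lam D F g) {H : UnitAddCircle → ℝ}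
    (hH : Integrable H) (hm : ∫ x in (0 : ℝ)..1, H (x : UnitAddCircle) = 0)
    (hfix : branchSum F g d (fun x : ℝ => H (x : UnitAddCircle)) =ᵐ[volume.restrict (Set.Ioc 0 1)]
      fun x : ℝ => H (x : UnitAddCircle)) :
    ∫ x in (0 : ℝ)..1, |H (x : UnitAddCircle)| = 0 := by
  set R : ℝ → ℝ := fun x => H (x : UnitAddCircle) with hR
  set L := branchSum F g d with hL
  have hRp : Function.Periodic R 1 := fun x => by simp only [hR, AddCircle.coe_add_period]
  have hRi : IntervalIntegrable R volume 0 1 := by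
    rw [intervalIntegrable_iff_integrableOn_Ioc_of_le zero_le_one]
    have := (UnitAddCircle.measurePreserving_mk 0).integrable_comp_of_integrable hH
    rw [zero_add] at this
    exact this
  have hii {w : ℝ → ℝ} (hw : ContDiff ℝ 1 w) : IntervalIntegrable w volume 0 1 :=
    hw.continuous.intervalIntegrable _ _
  -- the iterates of the fixed function stay equal to it almost everywhere
  have hiter (n : ℕ) : (L ^ n) R =ᵐ[volume.restrict (Set.Ioc 0 1)] R := by
    induction n with
    | zero => simp
    | succ n ih =>
      have hp := (h.pow_periodic hRp n).sub hRp
      have hi : IntervalIntegrable ((L ^ n) R - R) volume 0 1 :=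
        (h.integral_abs_pow_branchSum_le hRp hRi n).1.sub hRi
      have h0 : ∫ x in (0 : ℝ)..1, |((L ^ n) R - R) x| = 0 := by
        rw [intervalIntegral.integral_of_le zero_le_one]
        refine integral_eq_zero_of_ae ?_
        filter_upwards [ih] with x hx
        simp [hx]
      have h1 : ∫ x in (0 : ℝ)..1, |L ((L ^ n) R - R) x| = 0 :=
        le_antisymm ((h.integral_abs_branchSum_le hp hi).trans_eq h0)
          (intervalIntegral.integral_nonneg zero_le_one fun x _ => abs_nonneg _)
      rw [intervalIntegral.integral_of_le zero_le_one, integral_eq_zero_iff_of_nonneg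
        (fun x => abs_nonneg _) (h.integral_branchSum hp hi).1.abs.1] at h1
      filter_upwards [h1, hfix] with x hx hx'
      rw [map_sub] at hx
      have := abs_eq_zero.1 hx
      rw [pow_succ', Module.End.mul_apply]
      rw [Pi.sub_apply, sub_eq_zero] at this
      rw [this, hx']
  have hsmall (e : ℝ) (he : 0 < e) : ∫ x in (0 : ℝ)..1, |R x| ≤ 2 * e := by
    obtain ⟨f, hf1, hfp, hf⟩ := exists_contDiff_one_near hH he
    set c := ∫ x in (0 : ℝ)..1, f x with hc
    have hce : |c| ≤ e := by
      have : c = -∫ x in (0 : ℝ)..1, (R x - f x) := by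
        rw [intervalIntegral.integral_sub hRi (hii hf1), hm]; ring
      rw [this, abs_neg]
      exact (intervalIntegral.abs_integral_le_integral_abs zero_le_one).trans hf
    set u : ℝ → ℝ := fun x => f x - c with hu
    have hu1 : ContDiff ℝ 1 u := hf1.sub contDiff_const
    have hup : Function.Periodic u 1 := fun x => by simp only [hu, hfp x]
    have hum : ∫ x in (0 : ℝ)..1, u x = 0 := by
      rw [hu, intervalIntegral.integral_sub (hii hf1) (by simp)]; simp [hc]
    obtain ⟨B₁, hB₁, hb₁⟩ := exists_abs_le_of_periodic hup hu1.continuous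
    obtain ⟨B₂, hB₂, hb₂⟩ := exists_abs_le_of_periodic (periodic_deriv_of_periodic hup)
      (hu1.continuous_deriv le_rfl)
    have hdec := h.decay hu1 hup hum (fun y => (hb₁ y).trans (le_max_left B₁ B₂))
      (fun y => (hb₂ y).trans (le_max_right B₁ B₂))
    have hRu : ∫ x in (0 : ℝ)..1, |(R - u) x| ≤ 2 * e := by
      calc ∫ x in (0 : ℝ)..1, |(R - u) x| ≤ ∫ x in (0 : ℝ)..1, (|R x - f x| + e) := by
            refine intervalIntegral.integral_mono_on zero_le_one (hRi.sub (hii hu1)).abs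
              ((hRi.sub (hii hf1)).abs.add (by simp)) fun x _ => ?_
            have : (R - u) x = (R x - f x) + c := by simp [hu]; ring
            rw [this]
            exact (abs_add_le _ _).trans (by linarith)
        _ ≤ 2 * e := by
            rw [intervalIntegral.integral_add (hRi.sub (hii hf1)).abs (by simp)]
            simp
            linarith
    have hlim : Tendsto (fun n : ℕ => 2 * e +
        decayConst lam D * max B₁ B₂ * contractionRate lam D ^ n) atTop (𝓝 (2 * e)) := by
      have := ((tendsto_pow_atTop_nhds_zero_of_lt_one h.contractionRate_nonneg
        h.contractionRate_lt_one).const_mul (decayConst lam D * max B₁ B₂)).const_add (2 * e)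
      simpa using this
    refine ge_of_tendsto' hlim fun n => ?_
    have hRu' := h.integral_abs_pow_branchSum_le (hRp.sub hup) (hRi.sub (hii hu1)) n
    calc ∫ x in (0 : ℝ)..1, |R x| = ∫ x in (0 : ℝ)..1, |(L ^ n) R x| := by
          rw [intervalIntegral.integral_of_le zero_le_one,
            intervalIntegral.integral_of_le zero_le_one]
          refine integral_congr_ae ?_
          filter_upwards [hiter n] with x hx
          rw [hx]
      _ ≤ ∫ x in (0 : ℝ)..1, (|(L ^ n) (R - u) x| +
            decayConst lam D * max B₁ B₂ * contractionRate lam D ^ n) := by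
          refine intervalIntegral.integral_mono_on zero_le_one
            (h.integral_abs_pow_branchSum_le hRp hRi n).1.abs (hRu'.1.abs.add (by simp))
            fun x _ => ?_
          have : (L ^ n) R x = (L ^ n) (R - u) x + (L ^ n) u x := by rw [map_sub]; simp
          rw [this]
          exact (abs_add_le _ _).trans (add_le_add le_rfl (hdec n x).1)
      _ ≤ _ := by
          rw [intervalIntegral.integral_add hRu'.1.abs (by simp)]
          simp only [intervalIntegral.integral_const, sub_zero, one_smul]
          exact add_le_add (hRu'.2.trans hRu) le_rfl
  refine le_antisymm (le_of_forall_pos_le_add fun e he => ?_)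
    (intervalIntegral.integral_nonneg zero_le_one fun x _ => abs_nonneg _)
  have := hsmall (e / 2) (by positivity)
  linarith

theorem isUniqueInvariantDensity (h : ExpandingLift r d lam D F g)
    {T : UnitAddCircle → UnitAddCircle} (hF : IsLift F T) {ρ : UnitAddCircle → ℝ}
    (hc : Continuous fun x : ℝ => ρ (x : UnitAddCircle)) (h0 : ∀ x, 0 ≤ ρ x)
    (h1 : ∫ x in (0 : ℝ)..1, ρ (x : UnitAddCircle) = 1)
    (hfix : branchSum F g d (fun x : ℝ => ρ (x : UnitAddCircle)) =
      fun x : ℝ => ρ (x : UnitAddCircle)) : IsUniqueInvariantDensity T ρ := by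
  have hρc : Continuous ρ := isQuotientMap_quotient_mk'.continuous_iff.2 hc
  have hρi : Integrable ρ :=
    hρc.integrable_of_hasCompactSupport (HasCompactSupport.of_compactSpace ρ)
  have hint (w : UnitAddCircle → ℝ) : ∫ z, w z = ∫ x in (0 : ℝ)..1, w (x : UnitAddCircle) := by
    rw [← UnitAddCircle.intervalIntegral_preimage 0, zero_add]
  have hmp := UnitAddCircle.measurePreserving_mk 0
  rw [zero_add] at hmp
  refine ⟨⟨hρi, Eventually.of_forall h0, (hint ρ).trans h1, Eventually.of_forall fun z => ?_⟩,
    fun ρ' hρ' => ?_⟩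
  · obtain ⟨x, rfl⟩ := QuotientAddGroup.mk_surjective z
    exact (h.transferOperator_coe hF ρ x).trans (congrFun hfix x)
  · have hH : Integrable fun z => ρ' z - ρ z := hρ'.integrable.sub hρi
    have hz : ∫ z, |ρ' z - ρ z| = 0 := by
      rw [hint]
      refine h.integral_abs_eq_zero_of_fixed (H := fun z => ρ' z - ρ z) hH ?_ ?_
      · rw [← hint fun z => ρ' z - ρ z, integral_sub hρ'.integrable hρi, hρ'.integral_eq_one,
          hint ρ, h1, sub_self]
      · filter_upwards [hmp.quasiMeasurePreserving.ae hρ'.fixed] with x hx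
        have e1 := h.transferOperator_coe hF ρ' x
        have e2 : branchSum F g d (fun x : ℝ => ρ' (x : UnitAddCircle) - ρ (x : UnitAddCircle)) =
            branchSum F g d (fun x : ℝ => ρ' (x : UnitAddCircle)) -
              branchSum F g d (fun x : ℝ => ρ (x : UnitAddCircle)) := by
          rw [← map_sub]; rfl
        rw [e2, hfix, Pi.sub_apply, ← e1]
        exact congrArg (· - ρ (x : UnitAddCircle)) hx
    rw [integral_eq_zero_iff_of_nonneg (fun z => abs_nonneg _) hH.abs] at hz
    filter_upwards [hz] with z hz
    exact sub_eq_zero.1 (abs_eq_zero.1 hz)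

end ExpandingLift

/-! ### Expansion of the transfer operator along a family -/

/-- The filter of uniform limits: `u p → 0` along it means that `u (δ, x) → 0` as `δ → 0`, `δ ≠ 0`,
uniformly in `x`. -/
abbrev smallUniform : Filter (ℝ × ℝ) := 𝓝[≠] 0 ×ˢ ⊤

theorem abs_sub_le_of_abs_deriv_le {q : ℝ → ℝ} {M : ℝ} (hq : Differentiable ℝ q)
    (hM : ∀ x, |deriv q x| ≤ M) (y z : ℝ) : |q z - q y| ≤ M * |z - y| :=
  convex_univ.norm_image_sub_le_of_norm_deriv_le (fun x _ => hq x) (fun x _ => hM x)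
    (Set.mem_univ y) (Set.mem_univ z)

theorem contDiff_one_deriv {q : ℝ → ℝ} (hq : ContDiff ℝ 2 q) : ContDiff ℝ 1 (deriv q) := by
  rw [← one_add_one_eq_two] at hq
  exact (contDiff_succ_iff_deriv.1 hq).2.2

theorem abs_taylor_le {q : ℝ → ℝ} {M : ℝ} (hq : ContDiff ℝ 2 q)
    (hM : ∀ x, |deriv (deriv q) x| ≤ M) (y z : ℝ) :
    |q z - q y - deriv q y * (z - y)| ≤ M * |z - y| * |z - y| := by
  have hq' : ContDiff ℝ 1 (deriv q) :=
    contDiff_one_deriv hq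
  have hM0 : 0 ≤ M := (abs_nonneg _).trans (hM 0)
  have hd (x : ℝ) : HasDerivAt (fun t => q t - deriv q y * t) (deriv q x - deriv q y) x := by
    have := (hq.differentiable two_ne_zero x).hasDerivAt.sub
      ((hasDerivAt_id x).const_mul (deriv q y))
    rw [mul_one] at this
    exact this
  have := (convex_uIcc y z).norm_image_sub_le_of_norm_hasDerivWithin_le
    (C := M * |z - y|) (fun x _ => (hd x).hasDerivWithinAt) (fun x hx => ?_)
    Set.left_mem_uIcc Set.right_mem_uIcc
  · rw [Real.norm_eq_abs, Real.norm_eq_abs] at this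
    rwa [show q z - q y - deriv q y * (z - y) =
      q z - deriv q y * z - (q y - deriv q y * y) by ring]
  · refine (abs_sub_le_of_abs_deriv_le (hq'.differentiable one_ne_zero) hM y x).trans
      (mul_le_mul_of_nonneg_left ?_ hM0)
    exact Set.abs_sub_left_of_mem_uIcc hx

theorem isBigO_one_of_periodic {w : ℝ → ℝ} (hw : Function.Periodic w 1) (hc : Continuous w)
    {α : Type*} (l : Filter α) (z : α → ℝ) : (fun p => w (z p)) =O[l] fun _ => (1 : ℝ) := by
  obtain ⟨B, -, hB⟩ := exists_abs_le_of_periodic hw hc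
  exact IsBigO.of_bound B (Eventually.of_forall fun p => by simpa using hB (z p))

theorem isBigO_mul_sub_mul {α : Type*} {l : Filter α} {u u' v v' e : α → ℝ}
    (hu : (fun p => u p - u' p) =O[l] e) (hv : (fun p => v p - v' p) =O[l] e)
    (hu' : u =O[l] fun _ => (1 : ℝ)) (hv' : v' =O[l] fun _ => (1 : ℝ)) :
    (fun p => u p * v p - u' p * v' p) =O[l] e := by
  have h1 := hu'.mul hv
  have h2 := hu.mul hv'
  simp only [one_mul, mul_one] at h1 h2
  exact (h1.add h2).congr_left fun p => by ring

theorem tendsto_fst_prodMk (z : ℝ × ℝ → ℝ) :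
    Tendsto (fun p : ℝ × ℝ => (p.1, z p)) smallUniform smallUniform :=
  tendsto_fst.prodMk tendsto_top

theorem isLittleO_comp_snd {u : ℝ × ℝ → ℝ} (hu : u =o[smallUniform] Prod.fst) (z : ℝ × ℝ → ℝ) :
    (fun p => u (p.1, z p)) =o[smallUniform] Prod.fst :=
  hu.comp_tendsto (tendsto_fst_prodMk z)

theorem isBigO_comp_snd {u : ℝ × ℝ → ℝ} (hu : u =O[smallUniform] Prod.fst) (z : ℝ × ℝ → ℝ) :
    (fun p => u (p.1, z p)) =O[smallUniform] Prod.fst :=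
  hu.comp_tendsto (tendsto_fst_prodMk z)

theorem isBigO_fst_one : (Prod.fst : ℝ × ℝ → ℝ) =O[smallUniform] fun _ => (1 : ℝ) := by
  refine IsBigO.of_bound 1 ?_
  have : ∀ᶠ δ : ℝ in 𝓝[≠] 0, |δ| ≤ 1 := by
    refine eventually_nhdsWithin_of_eventually_nhds ?_
    filter_upwards [Metric.closedBall_mem_nhds (0 : ℝ) one_pos] with δ hδ
    simpa using hδ
  filter_upwards [this.prod_inl (⊤ : Filter ℝ)] with p hp
  simpa using hp

theorem tendsto_fst_zero : Tendsto (Prod.fst : ℝ × ℝ → ℝ) smallUniform (𝓝 0) :=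
  (tendsto_nhdsWithin_iff.1 (tendsto_fst (f := 𝓝[≠] (0 : ℝ)) (g := (⊤ : Filter ℝ)))).1

theorem isLittleO_fst_of_isBigO_sq {u : ℝ × ℝ → ℝ}
    (hu : u =O[smallUniform] fun p => p.1 * p.1) : u =o[smallUniform] Prod.fst := by
  refine hu.trans_isLittleO ?_
  have h1 : (Prod.fst : ℝ × ℝ → ℝ) =o[smallUniform] fun _ => (1 : ℝ) :=
    (isLittleO_one_iff ℝ).2 tendsto_fst_zero
  have := h1.mul_isBigO (isBigO_refl (Prod.fst : ℝ × ℝ → ℝ) smallUniform)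
  simpa only [one_mul] using this

theorem isBigO_sub_of_isLittleO {u v : ℝ × ℝ → ℝ}
    {e : ℝ → ℝ} (he : Continuous e) (hep : Function.Periodic e 1)
    (huv : (fun p => u p - v p - p.1 * e p.2) =o[smallUniform] Prod.fst) :
    (fun p => u p - v p) =O[smallUniform] Prod.fst := by
  have h1 := (isBigO_refl (Prod.fst : ℝ × ℝ → ℝ) smallUniform).mul
    (isBigO_one_of_periodic hep he smallUniform Prod.snd)
  simp only [mul_one] at h1
  exact (huv.isBigO.add h1).congr_left fun p => by ring

/-- A perturbation `F δ = F 0 + δ E + o(δ)` of an expanding lift, with inverses `g δ`, for which the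
degree and the bounds `lam`, `D` do not depend on small `δ`. The remainder is controlled in `C^1`;
of the second derivatives only `F δ'' - F 0'' = O(δ)` is needed. -/
structure ExpandingFamily (d : ℕ) (lam D : ℝ) (F g : ℝ → ℝ → ℝ) (E : ℝ → ℝ) : Prop where
  base : ExpandingLift 3 d lam D (F 0) (g 0)
  eventually : ∀ᶠ δ in 𝓝[≠] (0 : ℝ), ExpandingLift 3 d lam D (F δ) (g δ)
  contDiff : ContDiff ℝ 3 E
  periodic : Function.Periodic E 1
  expansion : (fun p : ℝ × ℝ => F p.1 p.2 - F 0 p.2 - p.1 * E p.2) =o[smallUniform] Prod.fst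
  expansion_deriv : (fun p : ℝ × ℝ => deriv (F p.1) p.2 - deriv (F 0) p.2 - p.1 * deriv E p.2)
    =o[smallUniform] Prod.fst
  expansion_deriv_two : (fun p : ℝ × ℝ => deriv (deriv (F p.1)) p.2 - deriv (deriv (F 0)) p.2)
    =O[smallUniform] Prod.fst

namespace ExpandingFamily

variable {d : ℕ} {lam D : ℝ} {F g : ℝ → ℝ → ℝ} {E : ℝ → ℝ}

theorem eventually_smallUniform (h : ExpandingFamily d lam D F g E) :
    ∀ᶠ p : ℝ × ℝ in smallUniform, ExpandingLift 3 d lam D (F p.1) (g p.1) :=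
  h.eventually.prod_inl _

theorem isBigO_map_sub (h : ExpandingFamily d lam D F g E) :
    (fun p : ℝ × ℝ => F p.1 p.2 - F 0 p.2) =O[smallUniform] Prod.fst :=
  isBigO_sub_of_isLittleO h.contDiff.continuous h.periodic h.expansion

theorem isBigO_deriv_sub (h : ExpandingFamily d lam D F g E) :
    (fun p : ℝ × ℝ => deriv (F p.1) p.2 - deriv (F 0) p.2) =O[smallUniform] Prod.fst :=
  isBigO_sub_of_isLittleO (h.contDiff.continuous_deriv (by norm_num))
    (periodic_deriv_of_periodic h.periodic) h.expansion_deriv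

theorem isBigO_inverse_sub (h : ExpandingFamily d lam D F g E) :
    (fun p : ℝ × ℝ => g p.1 p.2 - g 0 p.2) =O[smallUniform] Prod.fst := by
  have h1 := h.isBigO_map_sub.comp_tendsto (tendsto_fst_prodMk fun p => g 0 p.2)
  refine IsBigO.trans (IsBigO.of_bound 1 ?_) h1
  filter_upwards [h.eventually_smallUniform] with p hp
  have hd : ∀ x, 1 ≤ deriv (F p.1) x := fun x => by
    have h2 := (hp.inv_deriv_le x).trans hp.lam_lt_one.le
    exact (inv_le_one_iff₀.1 h2).resolve_left (not_le.2 (hp.deriv_pos x))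
  have hmv : ∀ ⦃x y : ℝ⦄, x ≤ y → 1 * (y - x) ≤ F p.1 y - F p.1 x :=
    mul_sub_le_image_sub_of_le_deriv hp.differentiable hd
  have e1 : F p.1 (g p.1 p.2) = F 0 (g 0 p.2) := by rw [hp.right_inv, h.base.right_inv]
  simp only [Function.comp, Real.norm_eq_abs, one_mul]
  rw [← e1]
  rcases le_total (g p.1 p.2) (g 0 p.2) with hle | hle
  · have := hmv hle
    rw [abs_sub_comm, abs_of_nonneg (by linarith), abs_of_nonneg (by linarith)]
    linarith
  · have := hmv hle
    rw [abs_of_nonneg (by linarith), abs_sub_comm, abs_of_nonneg (by linarith)]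
    linarith

theorem isBigO_comp_inverse_sub (h : ExpandingFamily d lam D F g E) {w : ℝ → ℝ}
    (hw : ContDiff ℝ 1 w) (hp : Function.Periodic w 1) :
    (fun p : ℝ × ℝ => w (g p.1 p.2) - w (g 0 p.2)) =O[smallUniform] Prod.fst := by
  obtain ⟨M, -, hM⟩ := exists_abs_le_of_periodic (periodic_deriv_of_periodic hp)
    (hw.continuous_deriv le_rfl)
  refine IsBigO.trans (IsBigO.of_bound M (Eventually.of_forall fun p => ?_)) h.isBigO_inverse_sub
  exact abs_sub_le_of_abs_deriv_le (hw.differentiable one_ne_zero) hM _ _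

theorem isLittleO_taylor (h : ExpandingFamily d lam D F g E) {q : ℝ → ℝ} (hq : ContDiff ℝ 2 q)
    (hp : Function.Periodic (deriv (deriv q)) 1) :
    (fun p : ℝ × ℝ => q (g p.1 p.2) - q (g 0 p.2) -
      deriv q (g 0 p.2) * (g p.1 p.2 - g 0 p.2)) =o[smallUniform] Prod.fst := by
  have hq' : ContDiff ℝ 1 (deriv q) :=
    contDiff_one_deriv hq
  obtain ⟨M, hM0, hM⟩ := exists_abs_le_of_periodic hp (hq'.continuous_deriv le_rfl)
  refine isLittleO_fst_of_isBigO_sq (IsBigO.trans (IsBigO.of_bound M ?_)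
    (h.isBigO_inverse_sub.mul h.isBigO_inverse_sub))
  refine Eventually.of_forall fun p => (abs_taylor_le hq hM _ _).trans_eq ?_
  rw [norm_mul, Real.norm_eq_abs, mul_assoc]

theorem isBigO_inv_deriv_one (h : ExpandingFamily d lam D F g E) :
    (fun p : ℝ × ℝ => (deriv (F p.1) p.2)⁻¹) =O[smallUniform] fun _ => (1 : ℝ) := by
  refine IsBigO.of_bound lam ?_
  filter_upwards [h.eventually_smallUniform] with p hp
  rw [Real.norm_eq_abs, abs_of_nonneg (hp.inv_deriv_nonneg _)]
  simpa using hp.inv_deriv_le p.2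

theorem isBigO_inv_deriv_zero_one (h : ExpandingFamily d lam D F g E) :
    (fun p : ℝ × ℝ => (deriv (F 0) p.2)⁻¹) =O[smallUniform] fun _ => (1 : ℝ) :=
  isBigO_one_of_periodic h.base.inv_deriv_periodic
    (h.base.contDiff_inv_deriv (m := 0) (by norm_num)).continuous _ _

theorem inv_deriv_sub_eq (h : ExpandingFamily d lam D F g E) :
    (fun p : ℝ × ℝ => (deriv (F p.1) p.2)⁻¹ - (deriv (F 0) p.2)⁻¹) =ᶠ[smallUniform]
      fun p => -((deriv (F p.1) p.2)⁻¹ * (deriv (F 0) p.2)⁻¹) *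
        (deriv (F p.1) p.2 - deriv (F 0) p.2) := by
  filter_upwards [h.eventually_smallUniform] with p hp
  have h1 := (hp.deriv_pos p.2).ne'
  have h2 := (h.base.deriv_pos p.2).ne'
  field_simp
  ring

theorem isBigO_inv_deriv_sub (h : ExpandingFamily d lam D F g E) :
    (fun p : ℝ × ℝ => (deriv (F p.1) p.2)⁻¹ - (deriv (F 0) p.2)⁻¹) =O[smallUniform] Prod.fst := by
  refine h.inv_deriv_sub_eq.trans_isBigO ?_
  have := (h.isBigO_inv_deriv_one.mul h.isBigO_inv_deriv_zero_one).neg_left.mul h.isBigO_deriv_sub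
  simpa only [one_mul] using this

theorem isLittleO_inv_deriv (h : ExpandingFamily d lam D F g E) :
    (fun p : ℝ × ℝ => (deriv (F p.1) p.2)⁻¹ - (deriv (F 0) p.2)⁻¹ +
      p.1 * (deriv E p.2 * (deriv (F 0) p.2)⁻¹ ^ 2)) =o[smallUniform] Prod.fst := by
  have hE := isBigO_one_of_periodic (periodic_deriv_of_periodic h.periodic)
    (h.contDiff.continuous_deriv (by norm_num)) smallUniform Prod.snd
  have h1 := (h.isBigO_inv_deriv_one.mul h.isBigO_inv_deriv_zero_one).mul_isLittleO
    h.expansion_deriv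
  have h2 : (fun p : ℝ × ℝ => (p.1 * (deriv E p.2 * (deriv (F 0) p.2)⁻¹)) *
      ((deriv (F p.1) p.2)⁻¹ - (deriv (F 0) p.2)⁻¹)) =o[smallUniform] Prod.fst := by
    refine isLittleO_fst_of_isBigO_sq ?_
    have := ((isBigO_refl (Prod.fst : ℝ × ℝ → ℝ) smallUniform).mul
      (hE.mul h.isBigO_inv_deriv_zero_one)).mul h.isBigO_inv_deriv_sub
    simpa only [mul_one] using this
  simp only [one_mul] at h1
  refine ((h1.neg_left.sub h2).congr' ?_ EventuallyEq.rfl)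
  filter_upwards [h.inv_deriv_sub_eq] with p hp
  linear_combination -hp

/-- First-order expansion of the inverse: `g δ = g 0 - δ (E / (F 0)') ∘ g 0 + o(δ)`, uniformly. -/
theorem isLittleO_inverse (h : ExpandingFamily d lam D F g E) :
    (fun p : ℝ × ℝ => g p.1 p.2 - g 0 p.2 +
      p.1 * (E (g 0 p.2) * (deriv (F 0) (g 0 p.2))⁻¹)) =o[smallUniform] Prod.fst := by
  have hF2 : Function.Periodic (deriv (deriv (F 0))) 1 :=
    periodic_deriv_of_periodic h.base.deriv_periodic
  have h1 := h.expansion.comp_tendsto (tendsto_fst_prodMk fun p => g p.1 p.2)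
  have h2 := h.isLittleO_taylor (h.base.contDiff.of_le (by norm_num)) hF2
  have h3 : (fun p : ℝ × ℝ => p.1 * (E (g p.1 p.2) - E (g 0 p.2))) =o[smallUniform] Prod.fst :=
    isLittleO_fst_of_isBigO_sq ((isBigO_refl _ _).mul
      (h.isBigO_comp_inverse_sub (h.contDiff.of_le (by norm_num)) h.periodic))
  have h4 := h.isBigO_inv_deriv_zero_one.comp_tendsto (tendsto_fst_prodMk fun p => g 0 p.2)
  have h5 := h4.mul_isLittleO ((h1.add h2).add h3)
  simp only [Function.comp_def, one_mul] at h5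
  refine h5.neg_left.congr' ?_ EventuallyEq.rfl
  filter_upwards [h.eventually_smallUniform] with p hp
  have e1 : F p.1 (g p.1 p.2) = F 0 (g 0 p.2) := by rw [hp.right_inv, h.base.right_inv]
  have e2 := mul_inv_cancel₀ (h.base.deriv_pos (g 0 p.2)).ne'
  rw [e1]
  linear_combination (g p.1 p.2 - g 0 p.2) * e2

/-- One summand of `isLittleO_branchSum`. At `z = g δ x` and `y = g 0 x`, and with `a = 1 / (F 0)'`,
`q = a w`, the change of the weight contributes `-δ E' a q` and the displacement of the branch
contributes `q' (z - y) = -δ q' E a`; together they form `-δ a (E q)'`. -/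
theorem isLittleO_branch (h : ExpandingFamily d lam D F g E) {w : ℝ → ℝ}
    (hw : ContDiff ℝ 2 w) (hp : Function.Periodic w 1) :
    (fun p : ℝ × ℝ => (deriv (F p.1) (g p.1 p.2))⁻¹ * w (g p.1 p.2) -
      (deriv (F 0) (g 0 p.2))⁻¹ * w (g 0 p.2) + p.1 * ((deriv (F 0) (g 0 p.2))⁻¹ *
        deriv (fun t => (deriv (F 0) t)⁻¹ * (E * w) t) (g 0 p.2))) =o[smallUniform] Prod.fst := by
  set a : ℝ → ℝ := fun t => (deriv (F 0) t)⁻¹ with ha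
  have ha2 : ContDiff ℝ 2 a := h.base.contDiff_inv_deriv (m := 2) le_rfl
  have hap : Function.Periodic a 1 := h.base.inv_deriv_periodic
  have hE2 : ContDiff ℝ 2 E := h.contDiff.of_le (by norm_num)
  set q : ℝ → ℝ := fun t => a t * w t with hq
  have hq2 : ContDiff ℝ 2 q := ha2.mul hw
  have hqp : Function.Periodic q 1 := hap.mul hp
  set φ : ℝ → ℝ := fun t => deriv E t * a t ^ 2 * w t with hφ
  have hφ1 : ContDiff ℝ 1 φ := ((contDiff_one_deriv hE2).mul
    ((ha2.of_le one_le_two).pow 2)).mul (hw.of_le one_le_two)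
  have hφp : Function.Periodic φ 1 := fun t => by
    simp only [hφ, periodic_deriv_of_periodic h.periodic t, hap t, hp t]
  have t1 := (isBigO_one_of_periodic hp hw.continuous smallUniform
    fun p => g p.1 p.2).mul_isLittleO
      (h.isLittleO_inv_deriv.comp_tendsto (tendsto_fst_prodMk fun p => g p.1 p.2))
  have t2 := h.isLittleO_taylor hq2 (periodic_deriv_of_periodic (periodic_deriv_of_periodic hqp))
  have t3 := (isBigO_one_of_periodic (periodic_deriv_of_periodic hqp)
    (contDiff_one_deriv hq2).continuous smallUniform fun p => g 0 p.2).mul_isLittleO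
      h.isLittleO_inverse
  have t4 : (fun p : ℝ × ℝ => p.1 * (φ (g p.1 p.2) - φ (g 0 p.2))) =o[smallUniform] Prod.fst :=
    isLittleO_fst_of_isBigO_sq ((isBigO_refl _ _).mul (h.isBigO_comp_inverse_sub hφ1 hφp))
  simp only [Function.comp_def, one_mul] at t1 t3
  refine (((t1.add t2).add t3).sub t4).congr_left fun p => ?_
  have hder : deriv (fun t => a t * (E * w) t) (g 0 p.2) =
      deriv E (g 0 p.2) * q (g 0 p.2) + E (g 0 p.2) * deriv q (g 0 p.2) := by
    rw [show (fun t => a t * (E * w) t) = fun t => E t * q t from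
      funext fun t => by rw [Pi.mul_apply, hq]; ring]
    exact deriv_fun_mul (hE2.differentiable two_ne_zero _) (hq2.differentiable two_ne_zero _)
  rw [hder]
  simp only [hφ, hq, ha]
  ring

/-- The transfer operators satisfy `L δ w = L 0 w - δ (L 0 (E w))' + o(δ)`, uniformly. -/
theorem isLittleO_branchSum (h : ExpandingFamily d lam D F g E) {w : ℝ → ℝ}
    (hw : ContDiff ℝ 2 w) (hp : Function.Periodic w 1) :
    (fun p : ℝ × ℝ => branchSum (F p.1) (g p.1) d w p.2 - branchSum (F 0) (g 0) d w p.2 +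
      p.1 * deriv (branchSum (F 0) (g 0) d (E * w)) p.2) =o[smallUniform] Prod.fst := by
  have hEw : ContDiff ℝ 1 (E * w) :=
    (h.contDiff.of_le (by norm_num)).mul (hw.of_le one_le_two)
  have hi (i : ℕ) := isLittleO_comp_snd (h.isLittleO_branch hw hp) fun p => p.2 + (i : ℝ)
  have hs := IsLittleO.sum (s := Finset.range d) fun i _ => hi i
  refine (hs.congr_left fun p => ?_)
  rw [h.base.deriv_branchSum hEw, branchSum_apply, branchSum_apply, branchSum_apply,
    Finset.mul_sum, ← Finset.sum_sub_distrib, ← Finset.sum_add_distrib, Finset.sum_apply]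

theorem isBigO_deriv_mul_sub (h : ExpandingFamily d lam D F g E) {w : ℝ → ℝ}
    (hw : ContDiff ℝ 1 w) (hp : Function.Periodic w 1) :
    (fun p : ℝ × ℝ => deriv (fun t => (deriv (F p.1) t)⁻¹ * w t) p.2 -
      deriv (fun t => (deriv (F 0) t)⁻¹ * w t) p.2) =O[smallUniform] Prod.fst := by
  have hdd := isBigO_one_of_periodic (periodic_deriv_of_periodic h.base.deriv_periodic)
    ((contDiff_one_deriv (h.base.contDiff.of_le (by norm_num))).continuous_deriv le_rfl)
    smallUniform Prod.snd
  have hsq := isBigO_mul_sub_mul h.isBigO_inv_deriv_sub h.isBigO_inv_deriv_sub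
    h.isBigO_inv_deriv_one h.isBigO_inv_deriv_zero_one
  have h1 := isBigO_mul_sub_mul hsq h.expansion_deriv_two
    (by simpa only [one_mul] using h.isBigO_inv_deriv_one.mul h.isBigO_inv_deriv_one) hdd
  have h2 := h1.mul (isBigO_one_of_periodic hp hw.continuous smallUniform Prod.snd)
  have h3 := h.isBigO_inv_deriv_sub.mul (isBigO_one_of_periodic (periodic_deriv_of_periodic hp)
    (hw.continuous_deriv le_rfl) smallUniform Prod.snd)
  simp only [mul_one] at h2 h3
  refine (h3.sub h2).congr' ?_ EventuallyEq.rfl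
  have hder {F g : ℝ → ℝ} (hF : ExpandingLift 3 d lam D F g) (t : ℝ) :
      deriv (fun t => (deriv F t)⁻¹ * w t) t =
        -((deriv F t)⁻¹ * (deriv F t)⁻¹ * deriv (deriv F) t) * w t +
          (deriv F t)⁻¹ * deriv w t := by
    have e1 := ((contDiff_one_deriv (hF.contDiff.of_le (by norm_num))).differentiable
      one_ne_zero t).hasDerivAt.inv (hF.deriv_pos t).ne'
    have e2 := e1.mul (hw.differentiable one_ne_zero t).hasDerivAt
    refine e2.deriv.trans ?_
    simp only [Pi.inv_apply]
    field_simp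
  filter_upwards [h.eventually_smallUniform] with p hp
  rw [hder hp, hder h.base]
  ring

theorem isBigO_deriv_branchSum_sub (h : ExpandingFamily d lam D F g E) {w : ℝ → ℝ}
    (hw : ContDiff ℝ 2 w) (hp : Function.Periodic w 1) :
    (fun p : ℝ × ℝ => deriv (branchSum (F p.1) (g p.1) d w) p.2 -
      deriv (branchSum (F 0) (g 0) d w) p.2) =O[smallUniform] Prod.fst := by
  have hw1 := hw.of_le one_le_two
  have ha2 := h.base.contDiff_inv_deriv (m := 2) le_rfl
  have haw := contDiff_one_deriv (ha2.mul hw)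
  have hawp := periodic_deriv_of_periodic (h.base.inv_deriv_periodic.mul hp)
  have h1 := isBigO_mul_sub_mul h.isBigO_inv_deriv_sub (h.isBigO_deriv_mul_sub hw1 hp)
    h.isBigO_inv_deriv_one (isBigO_one_of_periodic hawp haw.continuous smallUniform Prod.snd)
  have h2 := h.isBigO_comp_inverse_sub ((ha2.of_le one_le_two).mul haw)
    (h.base.inv_deriv_periodic.mul hawp)
  have h3 := (isBigO_comp_snd h1 fun p => g p.1 p.2).add h2
  have hi (i : ℕ) := isBigO_comp_snd h3 fun p => p.2 + (i : ℝ)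
  have hs := IsBigO.sum (s := Finset.range d) fun i _ => hi i
  refine hs.congr' ?_ EventuallyEq.rfl
  filter_upwards [h.eventually_smallUniform] with p hp
  rw [hp.deriv_branchSum hw1, h.base.deriv_branchSum hw1, branchSum_apply, branchSum_apply,
    ← Finset.sum_sub_distrib, Finset.sum_apply]
  refine Finset.sum_congr rfl fun i _ => ?_
  exact sub_add_sub_cancel _ _ _

/-- The resolvent argument: `u = (P δ - R) / δ - S` satisfies `u - L δ u = f δ`, where
`f δ = (L δ R - L 0 R) / δ - S + L δ S` tends to zero uniformly and is bounded in `C^1`. -/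
theorem uniform_response (h : ExpandingFamily d lam D F g E) {R S : ℝ → ℝ} {P : ℝ → ℝ → ℝ}
    (hR : ContDiff ℝ 2 R) (hRp : Function.Periodic R 1) (hR1 : ∫ x in (0 : ℝ)..1, R x = 1)
    (hRfix : branchSum (F 0) (g 0) d R = R)
    (hS : ContDiff ℝ 2 S) (hSp : Function.Periodic S 1) (hS0 : ∫ x in (0 : ℝ)..1, S x = 0)
    (hresp : deriv (branchSum (F 0) (g 0) d (E * R)) = branchSum (F 0) (g 0) d S - S)
    (hP : ∀ᶠ δ in 𝓝[≠] (0 : ℝ), ContDiff ℝ 1 (P δ) ∧ Function.Periodic (P δ) 1 ∧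
      ∫ x in (0 : ℝ)..1, P δ x = 1 ∧ branchSum (F δ) (g δ) d (P δ) = P δ) {e : ℝ} (he : 0 < e) :
    ∀ᶠ δ in 𝓝[≠] (0 : ℝ), ∀ x, |(P δ x - R x) / δ - S x| ≤ e := by
  set L : ℝ → Module.End ℝ (ℝ → ℝ) := fun δ => branchSum (F δ) (g δ) d with hL
  set f : ℝ → ℝ → ℝ := fun δ => δ⁻¹ • (L δ R - R) - S + L δ S with hf
  have hS1 := hS.of_le one_le_two
  have hR1' := hR.of_le one_le_two
  have hne : ∀ᶠ p : ℝ × ℝ in smallUniform, p.1 ≠ 0 :=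
    (eventually_mem_nhdsWithin (a := (0 : ℝ)) (s := {0}ᶜ)).prod_inl _
  have hinv {u : ℝ × ℝ → ℝ} (hu : u =O[smallUniform] Prod.fst) :
      (fun p => p.1⁻¹ * u p) =O[smallUniform] fun _ => (1 : ℝ) := by
    refine ((isBigO_refl (fun p : ℝ × ℝ => p.1⁻¹) smallUniform).mul hu).trans
      (IsBigO.of_bound 1 ?_)
    filter_upwards [hne] with p hp
    simp [hp]
  have hinv' {u : ℝ × ℝ → ℝ} (hu : u =o[smallUniform] Prod.fst) :
      (fun p => p.1⁻¹ * u p) =o[smallUniform] fun _ => (1 : ℝ) := by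
    refine ((isBigO_refl (fun p : ℝ × ℝ => p.1⁻¹) smallUniform).mul_isLittleO hu).trans_isBigO
      (IsBigO.of_bound 1 ?_)
    filter_upwards [hne] with p hp
    simp [hp]
  have hLSc : ContDiff ℝ 1 (L 0 S) := h.base.contDiff_branchSum (m := 1) (by norm_num) hS1
  have hLSp : Function.Periodic (L 0 S) 1 := h.base.branchSum_periodic hSp
  have hfsmall : (fun p : ℝ × ℝ => f p.1 p.2) =o[smallUniform] fun _ => (1 : ℝ) := by
    have h1 := hinv' (h.isLittleO_branchSum hR hRp)
    have h2 : (fun p : ℝ × ℝ => L p.1 S p.2 - L 0 S p.2) =o[smallUniform] fun _ => (1 : ℝ) := by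
      have hES : ContDiff ℝ 1 (E * S) := (h.contDiff.of_le (by norm_num)).mul hS1
      have hESp : Function.Periodic (E * S) 1 := h.periodic.mul hSp
      have := isBigO_sub_of_isLittleO (u := fun p => L p.1 S p.2) (v := fun p => L 0 S p.2)
        (e := fun x => -deriv (L 0 (E * S)) x)
        ((h.base.contDiff_branchSum (m := 1) (by norm_num) hES).continuous_deriv le_rfl).neg
        (fun x => congrArg Neg.neg
          (periodic_deriv_of_periodic (h.base.branchSum_periodic hESp) x))
        ((h.isLittleO_branchSum hS hSp).congr_left fun p => by simp only [hL]; ring)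
      exact this.trans_isLittleO ((isLittleO_one_iff ℝ).2 tendsto_fst_zero)
    refine (h1.add h2).congr' ?_ EventuallyEq.rfl
    filter_upwards [hne] with p hp
    rw [hresp, hRfix]
    simp only [hf, hL, Pi.add_apply, Pi.sub_apply, Pi.smul_apply, smul_eq_mul]
    field_simp
    ring
  have hfderiv : (fun p : ℝ × ℝ => deriv (f p.1) p.2) =O[smallUniform] fun _ => (1 : ℝ) := by
    have h1 := hinv (h.isBigO_deriv_branchSum_sub hR hRp)
    have h2 := (h.isBigO_deriv_branchSum_sub hS hSp).trans isBigO_fst_one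
    have h3 := isBigO_one_of_periodic (periodic_deriv_of_periodic hLSp)
      (hLSc.continuous_deriv le_rfl) smallUniform Prod.snd
    have h4 := isBigO_one_of_periodic (periodic_deriv_of_periodic hSp)
      (hS1.continuous_deriv le_rfl) smallUniform Prod.snd
    refine (((h1.sub h4).add (h2.add h3))).congr' ?_ EventuallyEq.rfl
    filter_upwards [h.eventually_smallUniform] with p hp
    have d1 := (hp.contDiff_branchSum (m := 1) (by norm_num) hR1').differentiable one_ne_zero p.2
    have d2 := (hp.contDiff_branchSum (m := 1) (by norm_num) hS1).differentiable one_ne_zero p.2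
    have d3 := hR1'.differentiable one_ne_zero p.2
    have d4 := hS1.differentiable one_ne_zero p.2
    have := (((d1.hasDerivAt.sub d3.hasDerivAt).const_smul p.1⁻¹).sub d4.hasDerivAt).add
      d2.hasDerivAt
    refine Eq.trans ?_ this.deriv.symm
    rw [hRfix, smul_eq_mul]
    ring
  obtain ⟨B₀, hB₀⟩ := hfderiv.bound
  set B := max B₀ 1 with hB
  set θ := contractionRate lam D with hθ
  have hθ0 : 0 ≤ θ := h.base.contractionRate_nonneg
  have hθ1 : θ < 1 := h.base.contractionRate_lt_one
  obtain ⟨N, hN⟩ : ∃ N : ℕ, decayConst lam D * B * θ ^ N * (1 - θ)⁻¹ ≤ e / 2 := by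
    have : Tendsto (fun N : ℕ => decayConst lam D * B * θ ^ N * (1 - θ)⁻¹) atTop
        (𝓝 (decayConst lam D * B * 0 * (1 - θ)⁻¹)) :=
      ((tendsto_pow_atTop_nhds_zero_of_lt_one hθ0 hθ1).const_mul _).mul_const _
    rw [mul_zero, zero_mul] at this
    exact (this.eventually (ge_mem_nhds (half_pos he))).exists
  set s := min 1 (e / 2 / ((N + 1) * Real.exp (coneConst lam D))) with hs
  have hs0 : 0 < s := lt_min one_pos (by positivity)
  have hsN : N * (Real.exp (coneConst lam D) * s) ≤ e / 2 := by
    have h1 : s ≤ e / 2 / ((N + 1) * Real.exp (coneConst lam D)) := min_le_right _ _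
    rw [le_div_iff₀ (by positivity)] at h1
    have h2 : 0 ≤ Real.exp (coneConst lam D) * s := by positivity
    linarith
  have e1 := mem_prod_top.1 (hfsmall.bound hs0)
  have e2 := mem_prod_top.1 hB₀
  filter_upwards [e1, e2, h.eventually, hP, eventually_mem_nhdsWithin] with δ hδ1 hδ2 hδ3 hδ4 hδ5
  obtain ⟨q1, q2, q3, q4⟩ := hδ4
  have hδ0 : δ ≠ 0 := hδ5
  set u : ℝ → ℝ := δ⁻¹ • (P δ - R) - S with hu
  have hufix : u - branchSum (F δ) (g δ) d u = f δ := by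
    simp only [hu, hf, hL, map_sub, map_smul, q4]
    module
  have hu1 : ContDiff ℝ 1 u := ((q1.sub hR1').const_smul δ⁻¹).sub hS1
  have hup : Function.Periodic u 1 := fun x => by
    simp only [hu, Pi.sub_apply, Pi.smul_apply, q2 x, hRp x, hSp x]
  have hum : ∫ x in (0 : ℝ)..1, u x = 0 := by
    have i1 := q1.continuous.intervalIntegrable (μ := volume) 0 1
    have i2 := hR.continuous.intervalIntegrable (μ := volume) 0 1
    have i3 := hS.continuous.intervalIntegrable (μ := volume) 0 1
    simp only [hu, Pi.sub_apply, Pi.smul_apply, smul_eq_mul]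
    rw [intervalIntegral.integral_sub ((i1.sub i2).const_mul _) i3,
      intervalIntegral.integral_const_mul, intervalIntegral.integral_sub i1 i2, q3, hR1, hS0]
    ring
  have hfs (x : ℝ) : |f δ x| ≤ s := by simpa using hδ1 x
  have hfB (x : ℝ) : |deriv (f δ) x| ≤ B := by
    have : |deriv (f δ) x| ≤ B₀ := by simpa using hδ2 x
    exact this.trans (le_max_left _ _)
  have hsB : s ≤ B := (min_le_left _ _).trans (le_max_right _ _)
  intro x
  have hx := hδ3.abs_le_of_sub_branchSum hu1 hup hum hufix hfs (fun x => (hfs x).trans hsB) hfB N x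
  have hux : u x = (P δ x - R x) / δ - S x := by
    simp only [hu, Pi.sub_apply, Pi.smul_apply, smul_eq_mul]
    ring
  rw [← hux]
  linarith

end ExpandingFamily

/-! ### Linear response on the circle -/

theorem circle_periodic (w : UnitAddCircle → ℝ) :
    Function.Periodic (fun x : ℝ => w (x : UnitAddCircle)) 1 := fun x => by
  simp only [AddCircle.coe_add_period]

theorem integral_circle_eq (w : UnitAddCircle → ℝ) :
    ∫ z, w z = ∫ x in (0 : ℝ)..1, w (x : UnitAddCircle) := by
  rw [← UnitAddCircle.intervalIntegral_preimage 0, zero_add]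

theorem CircleContDiff.continuous {n : ℕ} {w : UnitAddCircle → ℝ} (hw : CircleContDiff n w) :
    Continuous w :=
  isQuotientMap_quotient_mk'.continuous_iff.2 (ContDiff.continuous hw)

/-- The invariant density of a `C^r` expanding map: existence, uniqueness and regularity. -/
theorem exists_circle_density {r : ℕ} (hr : 2 ≤ r) {T : UnitAddCircle → UnitAddCircle}
    (hT : IsExpandingMap r T) :
    ∃ ρ : UnitAddCircle → ℝ, CircleContDiff (r - 1) ρ ∧ (∀ z, 0 < ρ z) ∧ ∫ z, ρ z = 1 ∧
      transferOperator T ρ = ρ ∧ IsUniqueInvariantDensity T ρ := by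
  obtain ⟨F, hF, hFc, c, hc, hcF⟩ := hT
  obtain ⟨d, D, g, h⟩ := exists_expandingLift hr hF hFc hc hcF
  obtain ⟨R, hR1, hRp, hR0, hRi, hRfix⟩ := h.exists_density
  set ρ : UnitAddCircle → ℝ := Function.Periodic.lift hRp with hρ
  have hρR : (fun x : ℝ => ρ (x : UnitAddCircle)) = R := rfl
  refine ⟨ρ, ?_, fun z => ?_, ?_, ?_, ?_⟩
  · exact h.contDiff_density hR1 hRp hRfix (by omega)
  · obtain ⟨x, rfl⟩ := QuotientAddGroup.mk_surjective z
    exact hR0 x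
  · rw [integral_circle_eq]; exact hRi
  · funext z
    obtain ⟨x, rfl⟩ := QuotientAddGroup.mk_surjective z
    exact (h.transferOperator_coe hF ρ x).trans (congrFun hRfix x)
  · refine h.isUniqueInvariantDensity hF hR1.continuous (fun z => ?_) hRi hRfix
    obtain ⟨x, rfl⟩ := QuotientAddGroup.mk_surjective z
    exact (hR0 x).le

theorem ExpandingLift.deriv_inv_deriv {r d : ℕ} {lam D : ℝ} {F g : ℝ → ℝ}
    (h : ExpandingLift r d lam D F g) (x : ℝ) :
    deriv (fun y => (deriv F y)⁻¹) x = -deriv (deriv F) x * (deriv F x)⁻¹ ^ 2 := by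
  have h1 := (((h.contDiff_deriv (m := 1) h.two_le_smoothness).differentiable
    one_ne_zero x).hasDerivAt.inv (h.deriv_pos x).ne').deriv
  refine h1.trans ?_
  rw [div_eq_mul_inv, inv_pow]

theorem eventually_forall_abs_le {u : ℝ × ℝ → ℝ} (hu : u =O[smallUniform] Prod.fst) {κ : ℝ}
    (hκ : 0 < κ) : ∀ᶠ δ in 𝓝[≠] (0 : ℝ), ∀ x, |u (δ, x)| ≤ κ := by
  have h1 := (hu.trans_isLittleO ((isLittleO_one_iff ℝ).2 tendsto_fst_zero)).bound hκ
  have h2 := mem_prod_top.1 h1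
  filter_upwards [h2] with δ hδ x
  simpa using hδ x

theorem isLittleO_of_tendstoUniformly {φ U : ℝ → ℝ → ℝ} {V e : ℝ → ℝ}
    (hφ : TendstoUniformly φ (fun _ => 0) (𝓝[≠] (0 : ℝ)))
    (hU : ∀ᶠ δ in 𝓝[≠] (0 : ℝ), ∀ x, φ δ x = (U δ x - V x) / δ - e x) :
    (fun p : ℝ × ℝ => U p.1 p.2 - V p.2 - p.1 * e p.2) =o[smallUniform] Prod.fst := by
  refine isLittleO_iff.2 fun c hc => ?_
  have h1 := Metric.tendstoUniformly_iff.1 hφ c hc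
  have h2 : ∀ᶠ δ in 𝓝[≠] (0 : ℝ), ∀ x, |U δ x - V x - δ * e x| ≤ c * |δ| := by
    filter_upwards [h1, hU, eventually_mem_nhdsWithin] with δ a1 a2 a3 x
    have hδ : δ ≠ 0 := a3
    have a4 := a1 x
    rw [dist_zero_left, Real.norm_eq_abs, a2] at a4
    have : U δ x - V x - δ * e x = ((U δ x - V x) / δ - e x) * δ := by field_simp
    rw [this, abs_mul]
    exact mul_le_mul_of_nonneg_right a4.le (abs_nonneg _)
  filter_upwards [h2.prod_inl ⊤] with p hp
  exact hp p.2

theorem deriv_sub_div_sub {U V e : ℝ → ℝ} (hU : Differentiable ℝ U) (hV : Differentiable ℝ V)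
    (he : Differentiable ℝ e) (δ : ℝ) :
    deriv (fun x => (U x - V x) / δ - e x) = fun x => (deriv U x - deriv V x) / δ - deriv e x :=
  funext fun x => ((((hU x).hasDerivAt.sub (hV x).hasDerivAt).div_const δ).sub
    (he x).hasDerivAt).deriv

/-- A differentiable family has lifts satisfying uniform bounds near `δ = 0`: the lifts converge in
`C^2`, and their degrees are integers within distance less than one of each other. -/
theorem IsDifferentiableFamily.exists_expandingFamily {T₀ : UnitAddCircle → UnitAddCircle}
    {ε : UnitAddCircle → ℝ} {η : ℝ} {T : ℝ → UnitAddCircle → UnitAddCircle} (hη : 0 < η)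
    (hT : IsDifferentiableFamily T₀ ε η T) :
    ∃ (d : ℕ) (lam D : ℝ) (F g : ℝ → ℝ → ℝ),
      ExpandingFamily d lam D F g (fun x : ℝ => ε (x : UnitAddCircle)) ∧
      ∀ δ, |δ| < η → IsLift (F δ) (T δ) := by
  obtain ⟨F, hF, hexp⟩ := hT.expansion
  set E : ℝ → ℝ := fun x => ε (x : UnitAddCircle) with hE
  have hE3 : ContDiff ℝ 3 E := hT.smooth
  have hEp : Function.Periodic E 1 := circle_periodic ε
  have h00 : |(0 : ℝ)| < η := by simpa using hη
  have hsmall : ∀ᶠ δ in 𝓝[≠] (0 : ℝ), |δ| < η := by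
    refine eventually_nhdsWithin_of_eventually_nhds ?_
    filter_upwards [Metric.ball_mem_nhds (0 : ℝ) hη] with δ hδ
    simpa using hδ
  have hF3 (δ : ℝ) (hδ : |δ| < η) : ContDiff ℝ 3 (F δ) := (hF δ hδ).2
  have hd1 {w : ℝ → ℝ} (hw : ContDiff ℝ 3 w) : Differentiable ℝ w :=
    hw.differentiable (by norm_num)
  have hd2 {w : ℝ → ℝ} (hw : ContDiff ℝ 3 w) : Differentiable ℝ (deriv w) :=
    (contDiff_one_deriv (hw.of_le (by norm_num))).differentiable one_ne_zero
  have hx0 := isLittleO_of_tendstoUniformly (U := F) (V := F 0) (e := E) (hexp 0 (by norm_num))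
    (Eventually.of_forall fun δ x => by rw [iteratedDeriv_zero])
  have hx1 := isLittleO_of_tendstoUniformly (U := fun δ => deriv (F δ)) (V := deriv (F 0))
    (e := deriv E) (hexp 1 (by norm_num)) (by
      filter_upwards [hsmall] with δ hδ x
      rw [iteratedDeriv_one, deriv_sub_div_sub (hd1 (hF3 δ hδ)) (hd1 (hF3 0 h00)) (hd1 hE3)])
  have hx2 := isLittleO_of_tendstoUniformly (U := fun δ => deriv (deriv (F δ)))
    (V := deriv (deriv (F 0))) (e := deriv (deriv E)) (hexp 2 (by norm_num)) (by
      filter_upwards [hsmall] with δ hδ x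
      rw [iteratedDeriv_succ, iteratedDeriv_one,
        deriv_sub_div_sub (hd1 (hF3 δ hδ)) (hd1 (hF3 0 h00)) (hd1 hE3),
        deriv_sub_div_sub (hd2 (hF3 δ hδ)) (hd2 (hF3 0 h00)) (hd2 hE3)])
  have hE'p := periodic_deriv_of_periodic hEp
  have hE'1 := contDiff_one_deriv (hE3.of_le (by norm_num))
  have hO0 := isBigO_sub_of_isLittleO hE3.continuous hEp hx0
  have hO1 := isBigO_sub_of_isLittleO hE'1.continuous hE'p hx1
  have hO2 := isBigO_sub_of_isLittleO (hE'1.continuous_deriv le_rfl)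
    (periodic_deriv_of_periodic hE'p) hx2
  -- the given lift of `T₀` differs from the expanding one by an integer
  obtain ⟨F', hF', hF'c, c, hc, hcF'⟩ := hT.expanding 0 h00
  obtain ⟨n, hn⟩ := (hF 0 h00).1.eq_add_int hF' (hF3 0 h00).continuous hF'c.continuous
  have hcF (x : ℝ) : c ≤ deriv (F 0) x := by
    rw [show F 0 = fun x => F' x + n from funext hn, deriv_add_const]
    exact hcF' x
  obtain ⟨d, D₀, g₀, h₀⟩ := exists_expandingLift (r := 3) (by norm_num) (hF 0 h00).1
    (hF3 0 h00) hc hcF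
  obtain ⟨M, hM0, hM⟩ := exists_abs_le_of_periodic (periodic_deriv_of_periodic h₀.deriv_periodic)
    ((contDiff_one_deriv ((hF3 0 h00).of_le (by norm_num))).continuous_deriv le_rfl)
  set c₁ := (1 + c) / 2 with hc₁
  have hc₁1 : 1 < c₁ := by rw [hc₁]; linarith
  have hc₁c : c₁ ≤ c := by rw [hc₁]; linarith
  have hbase : ExpandingLift 3 d c₁⁻¹ (max D₀ (M + 1)) (F 0) g₀ :=
    { h₀ with
      lam_lt_one := inv_lt_one_of_one_lt₀ hc₁1
      inv_deriv_le := fun x => (h₀.inv_deriv_le x).trans (inv_anti₀ (by linarith) hc₁c)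
      abs_deriv_inv_le := fun x => (h₀.abs_deriv_inv_le x).trans (le_max_left _ _) }
  have hev : ∀ᶠ δ in 𝓝[≠] (0 : ℝ),
      ∃ g, ExpandingLift 3 d c₁⁻¹ (max D₀ (M + 1)) (F δ) g := by
    filter_upwards [hsmall, eventually_forall_abs_le hO0 (κ := 1 / 4) (by norm_num),
      eventually_forall_abs_le hO1 (κ := (c - 1) / 2) (by linarith),
      eventually_forall_abs_le hO2 one_pos] with δ hδ b0 b1 b2
    have hcδ (x : ℝ) : c₁ ≤ deriv (F δ) x := by
      have t1 : -((c - 1) / 2) ≤ deriv (F δ) x - deriv (F 0) x := (abs_le.1 (b1 x)).1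
      have t2 := hcF x
      rw [hc₁]; linarith
    obtain ⟨d', D', g', h'⟩ := exists_expandingLift (r := 3) (by norm_num) (hF δ hδ).1
      (hF3 δ hδ) hc₁1 hcδ
    have hdd : d' = d := by
      have e1 := h'.map_add_one 0
      have e2 := h₀.map_add_one 0
      have a0 : -(1 / 4) ≤ F δ 0 - F 0 0 ∧ F δ 0 - F 0 0 ≤ 1 / 4 := abs_le.1 (b0 0)
      have a1 : -(1 / 4) ≤ F δ (0 + 1) - F 0 (0 + 1) ∧ F δ (0 + 1) - F 0 (0 + 1) ≤ 1 / 4 :=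
        abs_le.1 (b0 (0 + 1))
      rw [e1, e2] at a1
      have l1 : (d' : ℝ) < d + 1 := by linarith [a0.1, a1.2]
      have l2 : (d : ℝ) < d' + 1 := by linarith [a0.2, a1.1]
      have l1' : d' < d + 1 := by exact_mod_cast l1
      have l2' : d < d' + 1 := by exact_mod_cast l2
      omega
    subst hdd
    refine ⟨g', { h' with abs_deriv_inv_le := fun x => le_trans ?_ (le_max_right _ _) }⟩
    have ha0 := h'.inv_deriv_nonneg x
    have ha1 := (h'.inv_deriv_le x).trans h'.lam_lt_one.le
    have hb : |deriv (deriv (F δ)) x| ≤ M + 1 := by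
      have t : |deriv (deriv (F δ)) x - deriv (deriv (F 0)) x| ≤ 1 := b2 x
      have := abs_sub_abs_le_abs_sub (deriv (deriv (F δ)) x) (deriv (deriv (F 0)) x)
      linarith [hM x]
    rw [h'.deriv_inv_deriv, abs_mul, abs_neg, abs_of_nonneg (sq_nonneg (deriv (F δ) x)⁻¹)]
    have : (deriv (F δ) x)⁻¹ ^ 2 ≤ 1 := pow_le_one₀ ha0 ha1
    calc |deriv (deriv (F δ)) x| * (deriv (F δ) x)⁻¹ ^ 2 ≤ |deriv (deriv (F δ)) x| * 1 :=
          mul_le_mul_of_nonneg_left this (abs_nonneg _)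
      _ ≤ M + 1 := by rwa [mul_one]
  have hg : ∀ δ, ∃ g, (∃ g', ExpandingLift 3 d c₁⁻¹ (max D₀ (M + 1)) (F δ) g') →
      ExpandingLift 3 d c₁⁻¹ (max D₀ (M + 1)) (F δ) g := fun δ => by
    by_cases hex : ∃ g', ExpandingLift 3 d c₁⁻¹ (max D₀ (M + 1)) (F δ) g'
    · exact ⟨hex.choose, fun _ => hex.choose_spec⟩
    · exact ⟨0, fun hh => absurd hh hex⟩
  choose g hg using hg
  exact ⟨d, c₁⁻¹, max D₀ (M + 1), F, g, ⟨hg 0 ⟨g₀, hbase⟩, hev.mono fun δ hδ => hg δ hδ,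
    hE3, hEp, hx0, hx1, hO2⟩, fun δ hδ => (hF δ hδ).1⟩

theorem exists_isDifferentiableFamily {T₀ : UnitAddCircle → UnitAddCircle}
    (hT₀ : IsExpandingMap 3 T₀) {ε : UnitAddCircle → ℝ} (hε : CircleContDiff 3 ε) :
    ∃ η : ℝ, 0 < η ∧ ∃ T : ℝ → UnitAddCircle → UnitAddCircle,
      IsDifferentiableFamily T₀ ε η T := by
  obtain ⟨F, hF, hFc, c, hc, hcF⟩ := hT₀
  set E : ℝ → ℝ := fun x => ε (x : UnitAddCircle) with hE
  have hE3 : ContDiff ℝ 3 E := hε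
  have hF3 : ContDiff ℝ 3 F := hFc
  obtain ⟨M, hM0, hM⟩ := exists_abs_le_of_periodic
    (periodic_deriv_of_periodic (circle_periodic ε)) (hE3.continuous_deriv (by norm_num))
  have hlift (δ : ℝ) : IsLift (fun x => F x + δ * E x)
      (fun z => T₀ z + ((δ * ε z : ℝ) : UnitAddCircle)) := fun x => by
    simp only [hF x, hE, AddCircle.coe_add]
  have hsm (δ : ℝ) : ContDiff ℝ 3 (fun x => F x + δ * E x) := hF3.add (contDiff_const.mul hE3)
  -- for `|δ| < (c - 1) / (2 M)` the derivative stays above the midpoint of `1` and `c`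
  refine ⟨(c - 1) / (2 * M), div_pos (by linarith) (by linarith),
    fun δ z => T₀ z + ((δ * ε z : ℝ) : UnitAddCircle), hε, ?_, fun δ hδ => ?_, ?_⟩
  · funext z; simp
  · refine ⟨_, hlift δ, hsm δ, (1 + c) / 2, by linarith, fun x => ?_⟩
    have hd : deriv (fun x => F x + δ * E x) x = deriv F x + δ * deriv E x :=
      ((hF3.differentiable (by norm_num) x).hasDerivAt.add
        ((hE3.differentiable (by norm_num) x).hasDerivAt.const_mul δ)).deriv
    rw [hd]
    rw [lt_div_iff₀ (by linarith)] at hδ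
    have h1 : |δ * deriv E x| ≤ |δ| * M := by
      rw [abs_mul]; exact mul_le_mul_of_nonneg_left (hM x) (abs_nonneg _)
    have h2 := (abs_le.1 h1).1
    have h3 := hcF x
    linarith
  · refine ⟨fun δ x => F x + δ * E x, fun δ _ => ⟨hlift δ, hsm δ⟩, fun j _ => ?_⟩
    refine Metric.tendstoUniformly_iff.2 fun e he => ?_
    filter_upwards [eventually_mem_nhdsWithin] with δ hδ x
    have hδ0 : δ ≠ 0 := hδ
    have : (fun x : ℝ => (F x + δ * E x - (F x + 0 * E x)) / δ - ε (x : UnitAddCircle)) =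
        fun _ => 0 := by
      funext x
      simp only [hE]
      field_simp
      ring
    rw [this, iteratedDeriv_const]
    simpa using he

/-- A mean-zero `ρ₁` solving `(1 - L) ρ₁ = -(L (ε ρ₀))'` is the linear response to `ε`. -/
theorem isLinearResponse_of_deriv_transferOperator_eq {T₀ : UnitAddCircle → UnitAddCircle}
    (hT₀ : IsExpandingMap 3 T₀) {ε ρ₀ ρ₁ : UnitAddCircle → ℝ} (hε : CircleContDiff 3 ε)
    (hρ₀ : CircleContDiff 2 ρ₀) (hρ₀u : IsUniqueInvariantDensity T₀ ρ₀)
    (hρ₀fix : transferOperator T₀ ρ₀ = ρ₀) (hρ₁ : CircleContDiff 2 ρ₁)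
    (hmean : ∫ z, ρ₁ z = 0)
    (hresp : ∀ x : ℝ, deriv (fun t : ℝ => transferOperator T₀ (ε * ρ₀) (t : UnitAddCircle)) x =
      transferOperator T₀ ρ₁ (x : UnitAddCircle) - ρ₁ (x : UnitAddCircle)) :
    IsLinearResponse T₀ ε ρ₁ := by
  refine ⟨exists_isDifferentiableFamily hT₀ hε, fun η hη T hT => ?_⟩
  obtain ⟨d, lam, D, F, g, hfam, hlift⟩ := hT.exists_expandingFamily hη
  have hdens : ∀ δ, ∃ ρ : UnitAddCircle → ℝ, |δ| < η → CircleContDiff 2 ρ ∧ (∀ z, 0 < ρ z) ∧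
      ∫ z, ρ z = 1 ∧ transferOperator (T δ) ρ = ρ ∧ IsUniqueInvariantDensity (T δ) ρ := by
    intro δ
    by_cases hδ : |δ| < η
    · obtain ⟨ρ, hρ⟩ := exists_circle_density (r := 3) (by norm_num) (hT.expanding δ hδ)
      exact ⟨ρ, fun _ => hρ⟩
    · exact ⟨0, fun h => absurd h hδ⟩
  choose ρ hρ using hdens
  have h00 : |(0 : ℝ)| < η := by simpa using hη
  have hsmall : ∀ᶠ δ in 𝓝[≠] (0 : ℝ), |δ| < η := by
    refine eventually_nhdsWithin_of_eventually_nhds ?_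
    filter_upwards [Metric.ball_mem_nhds (0 : ℝ) hη] with δ hδ
    simpa using hδ
  have hρ0 : ρ 0 = ρ₀ := by
    obtain ⟨a1, -, -, -, a2⟩ := hρ 0 h00
    have := hρ₀u.2 (ρ 0) (hT.zero ▸ a2.1)
    exact (a1.continuous.ae_eq_iff_eq volume hρ₀.continuous).1 this
  have hlift0 : IsLift (F 0) T₀ := hT.zero ▸ hlift 0 h00
  refine ⟨ρ, fun δ hδ => (hρ δ hδ).2.2.2.2, ?_⟩
  have hunif {e : ℝ} (he : 0 < e) : ∀ᶠ δ in 𝓝[≠] (0 : ℝ), ∀ x : ℝ,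
      |(ρ δ (x : UnitAddCircle) - ρ₀ (x : UnitAddCircle)) / δ - ρ₁ (x : UnitAddCircle)| ≤ e := by
    refine hfam.uniform_response (R := fun x : ℝ => ρ₀ (x : UnitAddCircle))
      (S := fun x : ℝ => ρ₁ (x : UnitAddCircle)) (P := fun δ (x : ℝ) => ρ δ (x : UnitAddCircle))
      hρ₀ (circle_periodic _) ?_ ?_ hρ₁ (circle_periodic _) ?_ ?_ ?_ he
    · rw [← integral_circle_eq, hρ₀u.1.integral_eq_one]
    · funext x
      rw [← hfam.base.transferOperator_coe hlift0, hρ₀fix]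
    · rw [← integral_circle_eq, hmean]
    · funext x
      have h1 := hresp x
      rw [show (fun t : ℝ => transferOperator T₀ (ε * ρ₀) (t : UnitAddCircle)) =
        branchSum (F 0) (g 0) d (fun t : ℝ => (ε * ρ₀) (t : UnitAddCircle)) from
          funext fun t => hfam.base.transferOperator_coe hlift0 _ t,
        hfam.base.transferOperator_coe hlift0] at h1
      exact h1
    · filter_upwards [hsmall, hfam.eventually] with δ hδ hδ'
      obtain ⟨a1, -, a3, a4, -⟩ := hρ δ hδ
      refine ⟨a1.of_le (by norm_num), circle_periodic _, ?_, ?_⟩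
      · rw [← integral_circle_eq, a3]
      · funext x
        rw [← hδ'.transferOperator_coe (hlift δ hδ), a4]
  refine ENNReal.tendsto_nhds_zero.2 fun e he => ?_
  obtain ⟨s, hs0, hse⟩ : ∃ s : ℝ, 0 < s ∧ ENNReal.ofReal s ≤ e := by
    rcases eq_or_ne e ⊤ with rfl | he'
    · exact ⟨1, one_pos, le_top⟩
    · exact ⟨e.toReal, ENNReal.toReal_pos he.ne' he', (ENNReal.ofReal_toReal he').le⟩
  filter_upwards [hunif hs0] with δ hδ
  have hbd : ∀ᵐ z : UnitAddCircle, ‖(ρ δ z - ρ 0 z) / δ - ρ₁ z‖ ≤ s :=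
    Eventually.of_forall fun z => by
      obtain ⟨x, rfl⟩ := QuotientAddGroup.mk_surjective z
      rw [hρ0]
      exact hδ x
  refine (eLpNorm_le_of_ae_bound hbd).trans ?_
  simpa using hse

/-! ### Solving for the perturbation -/

/-- A smooth bump on the circle centred at `y`. Composing `expNegInvGlue` with
`cos (2 π (x - y)) - cos (2 π r)`, which is positive exactly within distance `r` of `y` modulo one,
makes it periodic without gluing. -/
theorem exists_smooth_bump {y r : ℝ} (hr : 0 < r) (hy0 : r ≤ y) (hy1 : y + r ≤ 1) :
    ∃ b : UnitAddCircle → ℝ, (∀ n : ℕ, CircleContDiff n b) ∧ b (y : UnitAddCircle) ≠ 0 ∧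
      ∀ x : ℝ, 0 < x → x < 1 → r ≤ |x - y| → b (x : UnitAddCircle) = 0 := by
  set β : ℝ → ℝ := fun x =>
    expNegInvGlue (Real.cos (2 * Real.pi * (x - y)) - Real.cos (2 * Real.pi * r)) with hβ
  have hβp : Function.Periodic β 1 := fun x => by
    simp only [hβ]
    rw [show 2 * Real.pi * (x + 1 - y) = 2 * Real.pi * (x - y) + 2 * Real.pi by ring,
      Real.cos_add_two_pi]
  have hpi := Real.pi_pos
  refine ⟨Function.Periodic.lift hβp, fun n => ?_, ?_, fun x hx0 hx1 hxy => ?_⟩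
  · have : ContDiff ℝ n β := expNegInvGlue.contDiff.comp
      ((Real.contDiff_cos.comp (contDiff_const.mul (contDiff_id.sub contDiff_const))).sub
        contDiff_const)
    exact this
  · have h1 : Real.cos (2 * Real.pi * r) < 1 := by
      rw [← Real.cos_zero]
      exact Real.cos_lt_cos_of_nonneg_of_le_pi le_rfl (by nlinarith) (by positivity)
    have : 0 < β y := expNegInvGlue.pos_of_pos (by
      simp only [sub_self, mul_zero, Real.cos_zero]; linarith)
    exact this.ne'
  · refine expNegInvGlue.zero_of_nonpos (sub_nonpos.2 ?_)
    rw [← Real.cos_abs, abs_mul, abs_of_pos (by positivity : 0 < 2 * Real.pi)]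
    have hlt : |x - y| ≤ 1 - r := abs_le.2 ⟨by linarith, by linarith⟩
    rcases le_total |x - y| (1 / 2) with hh | hh
    · exact Real.cos_le_cos_of_nonneg_of_le_pi (by positivity) (by nlinarith)
        (mul_le_mul_of_nonneg_left hxy (by positivity))
    · rw [← Real.cos_two_pi_sub]
      refine Real.cos_le_cos_of_nonneg_of_le_pi (by positivity) (by nlinarith) ?_
      nlinarith

namespace ExpandingLift

variable {r d : ℕ} {lam D : ℝ} {F g : ℝ → ℝ} {T : UnitAddCircle → UnitAddCircle}

/-- Functions of the form `φ ∘ T` pull out of the transfer operator. -/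
theorem branchSum_comp_mul (h : ExpandingLift r d lam D F g) (hF : IsLift F T)
    (φ w : UnitAddCircle → ℝ) (x : ℝ) :
    branchSum F g d (fun t : ℝ => φ (T t) * w t) x =
      φ x * branchSum F g d (fun t : ℝ => w t) x := by
  rw [branchSum_apply, branchSum_apply, Finset.mul_sum]
  refine Finset.sum_congr rfl fun i _ => ?_
  have : ((x + (i : ℝ) : ℝ) : UnitAddCircle) = x :=
    unitAddCircle_coe_eq_iff.2 ⟨i, by simp⟩
  rw [hF, h.right_inv, this]
  ring

/-- The equation `L (ε ρ) = G` has the solution `ε = (G / ρ) ∘ T`, because `L ρ = ρ`. -/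
theorem exists_comp_branchSum_eq (h : ExpandingLift r d lam D F g) (hF : IsLift F T)
    {ρ : UnitAddCircle → ℝ} (hρ : CircleContDiff (r - 1) ρ) (hρ0 : ∀ z, 0 < ρ z)
    (hfix : transferOperator T ρ = ρ) {G : ℝ → ℝ} (hG : ContDiff ℝ (r - 1 : ℕ) G)
    (hGp : Function.Periodic G 1) :
    ∃ φ : UnitAddCircle → ℝ, CircleContDiff (r - 1) (φ ∘ T) ∧
      ∀ x : ℝ, branchSum F g d (fun t : ℝ => φ (T t) * ρ t) x = G x := by
  have hFr : ContDiff ℝ (r - 1 : ℕ) F := h.contDiff.of_le (by norm_cast; omega)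
  refine ⟨fun z => Function.Periodic.lift hGp z / ρ z, ?_, fun x => ?_⟩
  · have hR : ContDiff ℝ (r - 1 : ℕ) (fun x : ℝ => ρ x) := hρ
    have h1 : ContDiff ℝ (r - 1 : ℕ) (fun x => G (F x) / ρ (F x)) :=
      (hG.comp hFr).div (hR.comp hFr) fun x => (hρ0 _).ne'
    have h2 : (fun x : ℝ => ((fun z => Function.Periodic.lift hGp z / ρ z) ∘ T) x) =
        fun x => G (F x) / ρ (F x) := funext fun x => by
      simp only [Function.comp, hF x]
      rfl
    unfold CircleContDiff
    rwa [h2]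
  · rw [h.branchSum_comp_mul hF (fun z => Function.Periodic.lift hGp z / ρ z),
      ← h.transferOperator_coe hF, hfix]
    exact div_mul_cancel₀ _ (hρ0 _).ne'

end ExpandingLift

/-- The `C^n` functions `v` with `L (v ρ) = 0`: the perturbations that do not change the density `ρ`
to first order. -/
def silentPerturbations (F g : ℝ → ℝ) (d n : ℕ) (ρ : UnitAddCircle → ℝ) :
    Submodule ℝ (UnitAddCircle → ℝ) where
  carrier := {v | CircleContDiff n v ∧ branchSum F g d (fun t : ℝ => v t * ρ t) = 0}
  add_mem' := fun {u v} hu hv => ⟨ContDiff.add hu.1 hv.1, by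
    rw [show (fun t : ℝ => (u + v) t * ρ t) =
      (fun t : ℝ => u t * ρ t) + fun t : ℝ => v t * ρ t from
        funext fun t => add_mul _ _ _, map_add, hu.2, hv.2, add_zero]⟩
  zero_mem' := ⟨contDiff_const, by
    rw [show (fun t : ℝ => (0 : UnitAddCircle → ℝ) t * ρ t) = 0 from
      funext fun t => zero_mul _, map_zero]⟩
  smul_mem' := fun a {v} hv => ⟨contDiff_const.mul hv.1, by
    rw [show (fun t : ℝ => (a • v) t * ρ t) = a • fun t : ℝ => v t * ρ t from
      funext fun t => mul_assoc _ _ _, map_smul, hv.2, smul_zero]⟩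

/-- For a bump `b`, the function `b - (L (b ρ) / ρ) ∘ T` lies in the kernel. If `b` is supported in
`(0, s)` with `s = g (F 0 + 1)`, its correction term takes equal values at `y` and at the point
`y' = g (F y + 1)` of the same fibre, and `y' ∈ (s, 1)` whenever `y ∈ (0, s)`. So
`v ↦ v y - v y'` recovers `b y`, and bumps at separated points give independent elements. -/
theorem ExpandingLift.not_finiteDimensional_silentPerturbations {r d : ℕ} {lam D : ℝ}
    {F g : ℝ → ℝ} {T : UnitAddCircle → UnitAddCircle} (h : ExpandingLift r d lam D F g)
    (hF : IsLift F T) {ρ : UnitAddCircle → ℝ} (hρ : CircleContDiff (r - 1) ρ)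
    (hρ0 : ∀ z, 0 < ρ z) (hfix : transferOperator T ρ = ρ) :
    ¬ FiniteDimensional ℝ (silentPerturbations F g d (r - 1) ρ) := by
  intro hfin
  set s := g (F 0 + 1) with hs
  have hd2 : (2 : ℝ) ≤ d := by exact_mod_cast h.two_le_degree
  have hs0 : 0 < s := by
    have := h.strictMono_inverse (by linarith : F 0 < F 0 + 1)
    rwa [h.left_inv] at this
  have hF1 : F 1 = F 0 + d := by simpa using h.map_add_one 0
  have hs1 : s < 1 := by
    have := h.strictMono_inverse (by linarith : F 0 + 1 < F 1)
    rwa [h.left_inv] at this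
  set y : ℕ → ℝ := fun n => s / 2 ^ (n + 1) with hy
  have hy0 (n : ℕ) : 0 < y n := by positivity
  have hyhalf {m n : ℕ} (hmn : m < n) : y n ≤ y m / 2 := by
    simp only [hy]
    rw [div_div, ← pow_succ]
    exact div_le_div_of_nonneg_left hs0.le (by positivity)
      (pow_le_pow_right₀ one_le_two (by omega))
  have hys (n : ℕ) : y n ≤ s / 2 := by
    have : (2 : ℝ) ^ 1 ≤ 2 ^ (n + 1) := pow_le_pow_right₀ one_le_two (by omega)
    simp only [hy]
    exact div_le_div_of_nonneg_left hs0.le two_pos (by simpa using this)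
  set y' : ℕ → ℝ := fun n => g (F (y n) + 1) with hy'
  have hy's (n : ℕ) : s < y' n :=
    h.strictMono_inverse (by linarith [h.strictMono (hy0 n)])
  have hy'1 (n : ℕ) : y' n < 1 := by
    have h1 := h.strictMono (by linarith [hys n] : y n < s)
    rw [hs, h.right_inv] at h1
    have := h.strictMono_inverse (by linarith : F (y n) + 1 < F 1)
    rwa [h.left_inv] at this
  have hTy (n : ℕ) : T (y' n : UnitAddCircle) = T (y n : UnitAddCircle) := by
    rw [hF, hF, hy', h.right_inv]
    exact unitAddCircle_coe_eq_iff.2 ⟨1, by simp⟩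
  have hb (n : ℕ) := exists_smooth_bump (y := y n) (r := y n / 4) (by linarith [hy0 n])
    (by linarith [hy0 n]) (by linarith [hys n, hy0 n])
  choose b hbc hby hb0 using hb
  have hb1 {m n : ℕ} (hmn : m ≠ n) : b n (y m : UnitAddCircle) = 0 := by
    refine hb0 n (y m) (hy0 m) (by linarith [hys m]) ?_
    rcases lt_or_gt_of_ne hmn with hlt | hlt
    · have := hyhalf hlt
      exact le_trans (by linarith [hy0 n, hy0 m]) (le_abs_self _)
    · have := hyhalf hlt
      exact le_trans (by linarith [hy0 n, hy0 m]) (neg_le_abs _)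
  have hb2 (m n : ℕ) : b n (y' m : UnitAddCircle) = 0 := by
    refine hb0 n (y' m) (by linarith [hy's m]) (hy'1 m) (le_trans ?_ (le_abs_self _))
    linarith [hys n, hy0 n, hy's m]
  have hproj (n : ℕ) : ∃ v : silentPerturbations F g d (r - 1) ρ,
      (v : UnitAddCircle → ℝ) (y n) - (v : UnitAddCircle → ℝ) (y' n) ≠ 0 ∧
      ∀ m, m ≠ n → (v : UnitAddCircle → ℝ) (y m) - (v : UnitAddCircle → ℝ) (y' m) = 0 := by
    have hbk : ContDiff ℝ (r - 1 : ℕ) (fun t : ℝ => b n t * ρ t) := (hbc n (r - 1)).mul hρ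
    obtain ⟨φ, hφc, hφ⟩ := h.exists_comp_branchSum_eq hF hρ hρ0 hfix (h.contDiff_branchSum
      (by have := h.two_le_smoothness; omega) hbk)
      (h.branchSum_periodic (circle_periodic fun z => b n z * ρ z))
    refine ⟨⟨b n - φ ∘ T, ContDiff.sub (hbc n (r - 1)) hφc, ?_⟩, ?_, fun m hmn => ?_⟩
    · rw [show (fun t : ℝ => (b n - φ ∘ T) t * ρ t) = (fun t : ℝ => b n t * ρ t) -
        fun t : ℝ => φ (T t) * ρ t from funext fun t => sub_mul _ _ _, map_sub]
      funext x
      simp [hφ x]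
    · simpa [hTy, hb2] using hby n
    · simp [hTy, hb2, hb1 hmn]
  choose v hv0 hv1 using hproj
  have hli : LinearIndependent ℝ v := by
    rw [linearIndependent_iff']
    intro t c hsum m hm
    have hval (z : UnitAddCircle) : ∑ n ∈ t, c n * (v n : UnitAddCircle → ℝ) z = 0 := by
      have := congrFun (congrArg (Subtype.val) hsum) z
      simpa using this
    have h1 : ∑ n ∈ t, c n * ((v n : UnitAddCircle → ℝ) (y m) -
        (v n : UnitAddCircle → ℝ) (y' m)) = 0 := by
      simp only [mul_sub, Finset.sum_sub_distrib, hval, sub_zero]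
    rw [Finset.sum_eq_single_of_mem m hm fun n _ hn => by rw [hv1 n m hn.symm, mul_zero]] at h1
    exact (mul_eq_zero.1 h1).resolve_right (hv0 m)
  exact not_finite_iff_infinite.2 inferInstance (hli.finite : Finite ℕ)

theorem theorem1 (k : ℕ) (hk : 4 ≤ k) (T₀ : UnitAddCircle → UnitAddCircle)
    (hT₀ : IsExpandingMap k T₀) (ρ₁ : UnitAddCircle → ℝ) (hρ₁ : CircleContDiff (k - 2) ρ₁)
    (hmean : ∫ x, ρ₁ x ∂volume = 0) :
    ∃ (ε₀ : UnitAddCircle → ℝ) (V : Submodule ℝ (UnitAddCircle → ℝ)),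
      ¬ FiniteDimensional ℝ V ∧
      ∀ v ∈ V, CircleContDiff (k - 1) (ε₀ + v) ∧ IsLinearResponse T₀ (ε₀ + v) ρ₁ := by
  obtain ⟨ρ₀, hρc, hρpos, -, hρfix, hρu⟩ := exists_circle_density (by omega) hT₀
  obtain ⟨F, hF, hFc, c, hc, hcF⟩ := hT₀
  obtain ⟨d, D, g, h⟩ := exists_expandingLift (by omega : 2 ≤ k) hF hFc hc hcF
  set S : ℝ → ℝ := fun x => ρ₁ (x : UnitAddCircle) with hS
  have hSc : ContDiff ℝ (k - 2 : ℕ) S := hρ₁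
  have hSi : IntervalIntegrable S volume 0 1 := hSc.continuous.intervalIntegrable _ _
  -- solve `(L (ε ρ₀))' = L ρ₁ - ρ₁` by integrating the right-hand side, which has mean zero
  set H : ℝ → ℝ := branchSum F g d S - S with hH
  have hHc : ContDiff ℝ (k - 2 : ℕ) H := (h.contDiff_branchSum (by omega) hSc).sub hSc
  have hHp : Function.Periodic H 1 :=
    (h.branchSum_periodic (circle_periodic ρ₁)).sub (circle_periodic ρ₁)
  have hHm : ∫ x in (0 : ℝ)..1, H x = 0 := by
    obtain ⟨i1, i2⟩ := h.integral_branchSum (circle_periodic ρ₁) hSi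
    simp only [hH, Pi.sub_apply]
    rw [intervalIntegral.integral_sub i1 hSi, i2, sub_self]
  set G : ℝ → ℝ := fun x => ∫ t in (0 : ℝ)..x, H t with hG
  have hGd (x : ℝ) : HasDerivAt G (H x) x :=
    intervalIntegral.integral_hasDerivAt_right (hHc.continuous.intervalIntegrable _ _)
      hHc.continuous.aestronglyMeasurable.stronglyMeasurableAtFilter hHc.continuous.continuousAt
  have hGderiv : deriv G = H := funext fun x => (hGd x).deriv
  have hGc : ContDiff ℝ (k - 1 : ℕ) G := by
    have : ContDiff ℝ ((k - 2 : ℕ) + 1 : WithTop ℕ∞) G :=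
      contDiff_succ_iff_deriv.2 ⟨fun x => (hGd x).differentiableAt, by simp, hGderiv ▸ hHc⟩
    exact this.of_le (by norm_cast; omega)
  have hGp : Function.Periodic G 1 := fun x => by
    have i1 (s t : ℝ) : IntervalIntegrable H volume s t := hHc.continuous.intervalIntegrable _ _
    have := hHp.intervalIntegral_add_eq x 0
    rw [zero_add, hHm] at this
    simp only [hG]
    rw [← intervalIntegral.integral_add_adjacent_intervals (i1 0 x) (i1 x (x + 1)), this, add_zero]
  obtain ⟨φ₀, hφ₀c, hφ₀⟩ := h.exists_comp_branchSum_eq hF hρc hρpos hρfix hGc hGp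
  refine ⟨φ₀ ∘ T₀, silentPerturbations F g d (k - 1) ρ₀,
    h.not_finiteDimensional_silentPerturbations hF hρc hρpos hρfix, fun v hv => ?_⟩
  have hcd : CircleContDiff (k - 1) (φ₀ ∘ T₀ + v) := ContDiff.add hφ₀c hv.1
  refine ⟨hcd, isLinearResponse_of_deriv_transferOperator_eq ?_ (hcd.of_le ?_)
    (hρc.of_le ?_) hρu hρfix (hρ₁.of_le ?_) hmean fun x => ?_⟩
  · exact ⟨F, hF, hFc.of_le (by norm_cast; omega), c, hc, hcF⟩
  · norm_cast; omega
  · norm_cast; omega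
  · norm_cast; omega
  · have hL : (fun t : ℝ => transferOperator T₀ ((φ₀ ∘ T₀ + v) * ρ₀) (t : UnitAddCircle)) = G := by
      funext t
      rw [h.transferOperator_coe hF,
        show (fun t : ℝ => ((φ₀ ∘ T₀ + v) * ρ₀) (t : UnitAddCircle)) =
          (fun t : ℝ => φ₀ (T₀ t) * ρ₀ t) + fun t : ℝ => v t * ρ₀ t from
          funext fun t => add_mul _ _ _, map_add, hv.2, add_zero, hφ₀]
    rw [hL, hGderiv, h.transferOperator_coe hF]
    rfl
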